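/- Fix an integer $b\ge 1$ and put $r=\frac{b}{2b+1}$. Let $G_0$ be the graph with two vertices $q_1,q_2$ joined by one edge, and let $G_\ell$ arise from $G_{\ell-1}$ by replacing each edge with two new vertices, each joined by one edge to one of the two old end points, and joined to each other by $b$ parallel edges. Let $V_*=\bigcup_\ell V_\ell$ be the set of all vertices, and let $F_i:V_*\to V_*$ $(1\le i\le b+2)$ be the maps that realize $G_{\ell+1}$ as $b+2$ glued copies of $G_\ell$, one for each edge of $G_1$. For $f:V_*\to\mathbb R$ let $$\mathcal E_\ell(f)=r^{-\ell}\sum_{p\sim q\text{ in }G_\ell}|f(p)-f(q)|^2\quad\text{(with multiplicity)},\qquad \mathcal E(f)=\lim_{\ell\to\infty}\mathcal E_\ell(f),\qquad \operatorname{dom}\mathcal E=\{f:\mathcal E(f)<\infty\},$$ and let $\mathcal E(\cdot,\cdot)$ be the bilinear form obtained by polarization. The resistance metric $R(p,q)$ is the least $R\ge 0$ with $|f(p)-f(q)|^2\le R\,\mathcal E(f)$ for all $f\in\operatorname{dom}\mathcal E$. The bubble-diamond fractal $K_b$ is the $R$-completion of $V_*$; the $F_i$ and all functions in $\operatorname{dom}\mathcal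 E$ are extended to $K_b$ by continuity. Let $\mu$ be the self-similar Borel probability measure on $K_b$, i.e. $\mu(A)=\frac1{b+2}\sum_{i=1}^{b+2}\mu(F_i^{-1}A)$. For $u\in\operatorname{dom}\mathcal E$ and $f$ continuous on $K_b$, one says that $u\in\operatorname{dom}\Delta$ with $\Delta u=f$ if $\mathcal E(u,g)=-\int_{K_b}fg\,d\mu$ for all $g\in\operatorname{dom}\mathcal E$ with $g(q_1)=g(q_2)=0$. For $j\ge0$ let $\mathcal H_j=\{f:\Delta^{j+1}f=0\}$, where it is part of the condition that $\Delta^{j+1}f$ is defined. For every $j\ge 0$ and $k\in\{1,2\}$ there is exactly one $f_{jk}\in\mathcal H_j$ with $$\Delta^m f_{jk}(q_n)=\delta_{jm}\delta_{kn}\qquad(0\le m\le j,\ n=1,2).$$ Moreover, for every $j\ge 0$: (a) $\mathcal H_j$ is a real vector space of dimension $2j+2$, and $\{f_{mk}:0\le m\le j,\ k=1,2\}$ is a basis of it. Furthermore, $f\in\mathcal H_j$ if and only if $$f=\sum_{m=0}^{j}\sum_{k=1}^{2}\bigl(\Delta^m f(q_k)\bigr)f_{mk}.$$ (b) For all $i\in\{1,\dots,b+2\}$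 and $k\in\{1,2\}$, $$f_{jk}\circ F_i=\sum_{m=0}^{j}\sum_{n=1}^{2}\Bigl(\frac{r}{b+2}\Bigr)^m f_{(j-m)k}(F_iq_n)\,f_{mn}.$$ -/

import Mathlib

open scoped BigOperators
open MeasureTheory Filter Topology

noncomputable section

/-- The vertex set `V_*` of all bubble-diamond graphs `G_ℓ` with branching parameter `b`.
The edges of `G_ℓ` are indexed by the words `w` of length `ℓ` over `Fin (b + 2)`.
`q 0`, `q 1` are the two vertices of `G_0`; when `G_{ℓ+1}` is made from `G_ℓ`, the edge `w` is
modified by introducing the two new vertices `mid w 0` and `mid w 1`.  Hence `V_ℓ` consists of the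
`q n` and of the `mid w n` with `w` of length less than `ℓ`. -/
inductive BubbleVertex (b : ℕ) : Type
  | q (n : Fin 2) : BubbleVertex b
  | mid (w : List (Fin (b + 2))) (n : Fin 2) : BubbleVertex b

namespace BubbleDiamond

open BubbleVertex

/-- The maps `F_i : V_* → V_*`.  The indices `i < b` are the `b` parallel copies in the middle, which
join `mid [] 0` to `mid [] 1`; index `b` is the copy that joins `q 0` to `mid [] 0`, and index
`b + 1` is the copy that joins `mid [] 1` to `q 1`. -/
def vertexMap {b : ℕ} (i : Fin (b + 2)) : BubbleVertex b → BubbleVertex b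
  | .q n =>
      if (i : ℕ) = b then (if n = 0 then q 0 else mid [] 0)
      else if (i : ℕ) = b + 1 then (if n = 0 then mid [] 1 else q 1)
      else mid [] n
  | .mid w n => mid (i :: w) n

/-- `F_w = F_{w_1} ∘ ⋯ ∘ F_{w_ℓ}` for a word `w`. -/
def wordMap {b : ℕ} : List (Fin (b + 2)) → BubbleVertex b → BubbleVertex b
  | [], p => p
  | i :: w, p => vertexMap i (wordMap w p)

/-- The `n`-th end point of the edge `w`. -/
def endpoint {b : ℕ} (w : List (Fin (b + 2))) (n : Fin 2) : BubbleVertex b :=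
  wordMap w (q n)

theorem wordMap_append {b : ℕ} (w v : List (Fin (b + 2))) (p : BubbleVertex b) :
    wordMap (w ++ v) p = wordMap w (wordMap v p) := by
  induction w with
  | nil => rfl
  | cons i w ih => simp [wordMap, ih]

theorem wordMap_mid {b : ℕ} (w : List (Fin (b + 2))) (n : Fin 2) :
    wordMap w (mid [] n) = mid w n := by
  induction w with
  | nil => rfl
  | cons i w ih => simp [wordMap, ih, vertexMap]

/-- The edges that replace the edge `w` at the next level: `b` parallel edges between the two new
vertices, and one edge from each new vertex to one of the old end points. -/
theorem endpoint_append {b : ℕ} (w : List (Fin (b + 2))) (i : Fin (b + 2)) (n : Fin 2) :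
    endpoint (w ++ [i]) n =
      if (i : ℕ) = b then (if n = 0 then endpoint w 0 else mid w 0)
      else if (i : ℕ) = b + 1 then (if n = 0 then mid w 1 else endpoint w 1)
      else mid w n := by
  simp only [endpoint, wordMap_append, wordMap, vertexMap]
  split_ifs <;> simp [wordMap_mid]

/-- The renormalization constant `r = b / (2b + 1)`. -/
def renorm (b : ℕ) : ℝ := (b : ℝ) / (2 * b + 1)

/-- The graph energy `𝓔_ℓ` on `G_ℓ`; parallel edges are counted with their multiplicity. -/
def levelEnergy {b : ℕ} (l : ℕ) (f : BubbleVertex b → ℝ) : ℝ :=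
  (renorm b)⁻¹ ^ l *
    ∑ w : Fin l → Fin (b + 2), |f (endpoint (List.ofFn w) 0) - f (endpoint (List.ofFn w) 1)| ^ 2

/-- `f ∈ dom 𝓔`, for `f` on `V_*`: the nondecreasing sequence `𝓔_ℓ f` is bounded. -/
def FiniteEnergy {b : ℕ} (f : BubbleVertex b → ℝ) : Prop :=
  BddAbove (Set.range fun l => levelEnergy l f)

/-- The graph energy `𝓔 f = lim 𝓔_ℓ f = sup 𝓔_ℓ f` of `f ∈ dom 𝓔`
(see `tendsto_levelEnergy`). -/
def energy {b : ℕ} (f : BubbleVertex b → ℝ) : ℝ := ⨆ l, levelEnergy l f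

/-- The resistance metric on `V_*`. -/
def resistance {b : ℕ} (p q : BubbleVertex b) : ℝ :=
  sInf {R : ℝ | 0 ≤ R ∧ ∀ f : BubbleVertex b → ℝ, FiniteEnergy f →
    |f p - f q| ^ 2 ≤ R * energy f}

/-! ### The graph energy is nondecreasing in the level -/

theorem renorm_pos (b : ℕ) [NeZero b] : 0 < renorm b := by
  have : (0 : ℝ) < b := by exact_mod_cast Nat.pos_of_ne_zero (NeZero.ne b)
  unfold renorm; positivity

theorem renorm_lt_half (b : ℕ) : renorm b < 1 / 2 := by
  unfold renorm
  rw [div_lt_div_iff₀ (by positivity) (by norm_num)]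
  linarith

theorem levelEnergy_zero {b : ℕ} (f : BubbleVertex b → ℝ) :
    levelEnergy 0 f = |f (q 0) - f (q 1)| ^ 2 := by
  simp [levelEnergy, endpoint, wordMap]

theorem levelEnergy_nonneg {b : ℕ} [NeZero b] (l : ℕ) (f : BubbleVertex b → ℝ) :
    0 ≤ levelEnergy l f := by
  have := renorm_pos b
  unfold levelEnergy; positivity

theorem levelEnergy_succ {b : ℕ} (l : ℕ) (f : BubbleVertex b → ℝ) :
    levelEnergy (l + 1) f = (renorm b)⁻¹ * ∑ i, levelEnergy l (f ∘ vertexMap i) := by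
  unfold levelEnergy
  rw [← Finset.mul_sum, ← mul_assoc, ← pow_succ', ← (Fin.consEquiv fun _ => Fin (b + 2)).sum_comp,
    Fintype.sum_prod_type]
  simp [endpoint, wordMap, Fin.consEquiv, List.ofFn_succ]

theorem levelEnergy_one {b : ℕ} (f : BubbleVertex b → ℝ) :
    levelEnergy 1 f = (renorm b)⁻¹ * (b * |f (mid [] 0) - f (mid [] 1)| ^ 2 +
      |f (q 0) - f (mid [] 0)| ^ 2 + |f (mid [] 1) - f (q 1)| ^ 2) := by
  have h : ∀ x : Fin b, (x : ℕ) ≠ b ∧ (x : ℕ) ≠ b + 1 := fun x => by omega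
  rw [levelEnergy_succ]
  simp only [levelEnergy_zero, Fin.sum_univ_castSucc, Function.comp, vertexMap, Fin.val_castSucc,
    Fin.val_last, (h _).1, (h _).2]
  simp

theorem levelEnergy_le_succ {b : ℕ} [NeZero b] (l : ℕ) (f : BubbleVertex b → ℝ) :
    levelEnergy l f ≤ levelEnergy (l + 1) f := by
  induction l generalizing f with
  | zero =>
    rw [levelEnergy_zero, levelEnergy_one]
    simp only [sq_abs]
    have hb : (0 : ℝ) < b := by exact_mod_cast Nat.pos_of_ne_zero (NeZero.ne b)
    have : (renorm b)⁻¹ = (2 * b + 1) / b := by simp [renorm]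
    rw [this, div_mul_eq_mul_div, le_div_iff₀ hb]
    set s := f (mid [] 0) - f (mid [] 1)
    set t := f (q 0) - f (mid [] 0)
    set u := f (mid [] 1) - f (q 1)
    have e : f (q 0) - f (q 1) = t + s + u := by simp only [s, t, u]; ring
    rw [e]
    nlinarith [sq_nonneg (b * s - t), sq_nonneg (b * s - u),
      mul_nonneg hb.le (sq_nonneg (t - u))]
  | succ l ih =>
    rw [levelEnergy_succ, levelEnergy_succ (l + 1)]
    have := renorm_pos b
    gcongr with i
    exact ih _

theorem monotone_levelEnergy {b : ℕ} [NeZero b] (f : BubbleVertex b → ℝ) :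
    Monotone fun l => levelEnergy l f :=
  monotone_nat_of_le_succ fun l => levelEnergy_le_succ l f

theorem tendsto_levelEnergy {b : ℕ} [NeZero b] {f : BubbleVertex b → ℝ} (hf : FiniteEnergy f) :
    Tendsto (fun l => levelEnergy l f) atTop (𝓝 (energy f)) :=
  tendsto_atTop_ciSup (monotone_levelEnergy f) hf

theorem levelEnergy_le_energy {b : ℕ} {f : BubbleVertex b → ℝ} (hf : FiniteEnergy f) (l : ℕ) :
    levelEnergy l f ≤ energy f := le_ciSup hf l

theorem energy_nonneg {b : ℕ} [NeZero b] (f : BubbleVertex b → ℝ) : 0 ≤ energy f :=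
  Real.iSup_nonneg fun l => levelEnergy_nonneg l f

theorem levelEnergy_comp_le {b : ℕ} [NeZero b] {f : BubbleVertex b → ℝ} (hf : FiniteEnergy f)
    (i : Fin (b + 2)) (l : ℕ) : levelEnergy l (f ∘ vertexMap i) ≤ renorm b * energy f := by
  have hr := renorm_pos b
  have h := levelEnergy_le_energy hf (l + 1)
  rw [levelEnergy_succ, inv_mul_le_iff₀ hr] at h
  refine le_trans ?_ h
  exact Finset.single_le_sum (f := fun i => levelEnergy l (f ∘ vertexMap i))
    (fun j _ => levelEnergy_nonneg l _) (Finset.mem_univ i)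

theorem FiniteEnergy.comp {b : ℕ} [NeZero b] {f : BubbleVertex b → ℝ} (hf : FiniteEnergy f)
    (i : Fin (b + 2)) : FiniteEnergy (f ∘ vertexMap i) :=
  ⟨renorm b * energy f, by rintro _ ⟨l, rfl⟩; exact levelEnergy_comp_le hf i l⟩

theorem energy_comp_le {b : ℕ} [NeZero b] {f : BubbleVertex b → ℝ} (hf : FiniteEnergy f)
    (i : Fin (b + 2)) : energy (f ∘ vertexMap i) ≤ renorm b * energy f :=
  ciSup_le fun l => levelEnergy_comp_le hf i l

/-! ### The resistance metric -/

theorem abs_sub_root_le {b : ℕ} [NeZero b] {f : BubbleVertex b → ℝ} (hf : FiniteEnergy f)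
    (p : BubbleVertex b) : |f p - f (q 0)| ≤ 5 * √(energy f) := by
  have hr := renorm_pos b
  have hr2 := renorm_lt_half b
  have hb : (1 : ℝ) ≤ b := by exact_mod_cast Nat.pos_of_ne_zero (NeZero.ne b)
  have main : ∀ {f : BubbleVertex b → ℝ}, FiniteEnergy f →
      |f (q 1) - f (q 0)| ≤ √(energy f) ∧ ∀ n, |f (mid [] n) - f (q 0)| ≤
        2 * (√(renorm b) * √(energy f)) := by
    intro f hf
    have h0 := levelEnergy_le_energy hf 0
    have h1 := levelEnergy_le_energy hf 1
    rw [levelEnergy_zero] at h0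
    rw [levelEnergy_one, inv_mul_le_iff₀ hr] at h1
    rw [← Real.sqrt_mul hr.le]
    have a1 : |f (q 0) - f (mid [] 0)| ≤ √(renorm b * energy f) :=
      Real.le_sqrt_of_sq_le (by
        nlinarith [sq_nonneg |f (mid [] 0) - f (mid [] 1)|, sq_nonneg |f (mid [] 1) - f (q 1)|])
    have a2 : |f (mid [] 0) - f (mid [] 1)| ≤ √(renorm b * energy f) :=
      Real.le_sqrt_of_sq_le (by
        nlinarith [sq_nonneg |f (mid [] 0) - f (mid [] 1)|, sq_nonneg |f (mid [] 1) - f (q 1)|,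
          sq_nonneg |f (q 0) - f (mid [] 0)|])
    refine ⟨by rw [abs_sub_comm]; exact Real.le_sqrt_of_sq_le h0, fun n => ?_⟩
    rw [abs_le] at a1 a2 ⊢
    fin_cases n <;> simp only [Fin.zero_eta, Fin.mk_one] <;> constructor <;>
      linarith [a1.1, a1.2, a2.1, a2.2]
  have hs : √(renorm b) ≤ 5 / 7 := by
    rw [Real.sqrt_le_left (by norm_num)]; linarith
  have hs0 := Real.sqrt_nonneg (renorm b)
  have step : ∀ {f : BubbleVertex b → ℝ}, FiniteEnergy f → ∀ n,
      |f (mid [] n) - f (q 0)| ≤ 10 / 7 * √(energy f) := by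
    intro f hf n
    have := (main hf).2 n
    nlinarith [Real.sqrt_nonneg (energy f)]
  cases p with
  | q n =>
    have h0 := Real.sqrt_nonneg (energy f)
    have h := (main hf).1
    fin_cases n
    · simp
    · simp only [Fin.mk_one]; linarith
  | mid w n =>
    induction w generalizing f with
    | nil =>
      have h0 := Real.sqrt_nonneg (energy f)
      have := step hf n
      linarith
    | cons i w ih =>
      have h := ih (hf.comp i)
      have h2 : √(energy (f ∘ vertexMap i)) ≤ √(renorm b) * √(energy f) := by
        rw [← Real.sqrt_mul hr.le]; exact Real.sqrt_le_sqrt (energy_comp_le hf i)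
      have h0 := Real.sqrt_nonneg (energy f)
      have h3 : |f (vertexMap i (q 0)) - f (q 0)| ≤ 10 / 7 * √(energy f) := by
        simp only [vertexMap]
        split_ifs with h1 h1
        · simp
        · exact step hf 1
        · exact step hf 0
      have h4 : f (mid (i :: w) n) - f (q 0) =
        ((f ∘ vertexMap i) (mid w n) - (f ∘ vertexMap i) (q 0)) +
          (f (vertexMap i (q 0)) - f (q 0)) := by simp [vertexMap]
      rw [h4]
      refine (abs_add_le _ _).trans ?_
      nlinarith

theorem resistance_set_mem {b : ℕ} [NeZero b] (p q : BubbleVertex b) :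
    (100 : ℝ) ∈ {R : ℝ | 0 ≤ R ∧ ∀ f : BubbleVertex b → ℝ, FiniteEnergy f →
      |f p - f q| ^ 2 ≤ R * energy f} := by
  refine ⟨by norm_num, fun f hf => ?_⟩
  have h1 := abs_sub_root_le hf p
  have h2 := abs_sub_root_le hf q
  have h3 : |f p - f q| ≤ 10 * √(energy f) := by
    rw [abs_le] at *; constructor <;> linarith [h1.1, h1.2, h2.1, h2.2]
  calc |f p - f q| ^ 2 ≤ (10 * √(energy f)) ^ 2 := by gcongr
    _ = 100 * energy f := by rw [mul_pow, Real.sq_sqrt (energy_nonneg f)]; norm_num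

theorem resistance_bddBelow {b : ℕ} (p q : BubbleVertex b) :
    BddBelow {R : ℝ | 0 ≤ R ∧ ∀ f : BubbleVertex b → ℝ, FiniteEnergy f →
      |f p - f q| ^ 2 ≤ R * energy f} := ⟨0, fun _ h => h.1⟩

theorem resistance_nonneg {b : ℕ} (p q : BubbleVertex b) : 0 ≤ resistance p q :=
  Real.sInf_nonneg fun _ h => h.1

theorem resistance_le {b : ℕ} {p q : BubbleVertex b} {R : ℝ} (hR : 0 ≤ R)
    (h : ∀ f : BubbleVertex b → ℝ, FiniteEnergy f → |f p - f q| ^ 2 ≤ R * energy f) :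
    resistance p q ≤ R := csInf_le (resistance_bddBelow p q) ⟨hR, h⟩

/-- The infimum that defines the resistance metric is attained. -/
theorem sq_le_resistance {b : ℕ} [NeZero b] (p q : BubbleVertex b) {f : BubbleVertex b → ℝ}
    (hf : FiniteEnergy f) : |f p - f q| ^ 2 ≤ resistance p q * energy f := by
  rcases (energy_nonneg f).eq_or_lt with h | h
  · have := (resistance_set_mem p q).2 f hf
    rw [← h] at this ⊢; simpa using this
  · rw [← div_le_iff₀ h]
    exact le_csInf ⟨_, resistance_set_mem p q⟩ fun R hR => (div_le_iff₀ h).2 (hR.2 f hf)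

theorem levelEnergy_min_add_max {b : ℕ} [NeZero b] (l : ℕ) (f : BubbleVertex b → ℝ) (c : ℝ) :
    levelEnergy l (fun x => min (f x) c) + levelEnergy l (fun x => max (f x) c) ≤
      levelEnergy l f := by
  have hr := renorm_pos b
  unfold levelEnergy
  rw [← mul_add, ← Finset.sum_add_distrib]
  gcongr with w
  simp only [sq_abs]
  generalize f (endpoint (List.ofFn w) 0) = x
  generalize f (endpoint (List.ofFn w) 1) = y
  rcases le_total x c with hx | hx <;> rcases le_total y c with hy | hy <;> simp [hx, hy] <;>
    nlinarith

theorem energy_min_add_max {b : ℕ} [NeZero b] {f : BubbleVertex b → ℝ} (hf : FiniteEnergy f)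
    (c : ℝ) : FiniteEnergy (fun x => min (f x) c) ∧ FiniteEnergy (fun x => max (f x) c) ∧
      energy (fun x => min (f x) c) + energy (fun x => max (f x) c) ≤ energy f := by
  have h1 : FiniteEnergy (fun x => min (f x) c) := ⟨energy f, by
    rintro _ ⟨l, rfl⟩
    linarith [levelEnergy_min_add_max l f c, levelEnergy_le_energy hf l,
      levelEnergy_nonneg l (fun x => max (f x) c)]⟩
  have h2 : FiniteEnergy (fun x => max (f x) c) := ⟨energy f, by
    rintro _ ⟨l, rfl⟩
    linarith [levelEnergy_min_add_max l f c, levelEnergy_le_energy hf l,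
      levelEnergy_nonneg l (fun x => min (f x) c)]⟩
  exact ⟨h1, h2, le_of_tendsto_of_tendsto'
    ((tendsto_levelEnergy h1).add (tendsto_levelEnergy h2)) (tendsto_levelEnergy hf)
    fun l => levelEnergy_min_add_max l f c⟩

theorem resistance_comm {b : ℕ} (p q : BubbleVertex b) : resistance p q = resistance q p := by
  unfold resistance; simp only [abs_sub_comm]

theorem resistance_triangle_aux {b : ℕ} [NeZero b] (p q z : BubbleVertex b)
    {f : BubbleVertex b → ℝ} (hf : FiniteEnergy f) (h1 : f z ≤ f p) :
    |f p - f z| ^ 2 ≤ (resistance p q + resistance q z) * energy f := by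
  have hE := energy_nonneg f
  have hR1 := resistance_nonneg p q
  have hR2 := resistance_nonneg q z
  have e1 := sq_le_resistance p q hf
  have e2 := sq_le_resistance q z hf
  rw [sq_abs] at *
  by_cases hq1 : f q ≤ f z
  · nlinarith
  by_cases hq2 : f p ≤ f q
  · nlinarith
  push Not at hq1 hq2
  obtain ⟨k1, k2, k3⟩ := energy_min_add_max hf (f q)
  have m1 := sq_le_resistance p q k2
  have m2 := sq_le_resistance q z k1
  simp only [sq_abs, min_self, max_self, max_eq_left hq2.le, min_eq_left hq1.le] at m1 m2
  have n1 := energy_nonneg (fun x => min (f x) (f q))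
  have n2 := energy_nonneg (fun x => max (f x) (f q))
  set E1 := energy (fun x => min (f x) (f q))
  set E2 := energy (fun x => max (f x) (f q))
  set R1 := resistance p q
  set R2 := resistance q z
  have hA : 0 < f p - f q := by linarith
  have hB : 0 < f q - f z := by linarith
  have hAB : f p - f z = (f p - f q) + (f q - f z) := by ring
  rw [hAB]
  set A := f p - f q
  set B := f q - f z
  have key : 2 * (A * B) ≤ R1 * E1 + R2 * E2 := by
    have : (A * B) ^ 2 ≤ (R1 * E1) * (R2 * E2) := by
      calc (A * B) ^ 2 = A ^ 2 * B ^ 2 := by ring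
        _ ≤ (R1 * E2) * (R2 * E1) := by gcongr
        _ = _ := by ring
    have a1 : 0 ≤ R1 * E1 := by positivity
    have a2 : 0 ≤ R2 * E2 := by positivity
    refine abs_le_of_sq_le_sq' ?_ (by positivity) |>.2
    nlinarith [sq_nonneg (R1 * E1 - R2 * E2)]
  nlinarith [mul_le_mul_of_nonneg_left k3 (add_nonneg hR1 hR2)]

theorem resistance_triangle {b : ℕ} [NeZero b] (p q z : BubbleVertex b) :
    resistance p z ≤ resistance p q + resistance q z := by
  refine resistance_le (add_nonneg (resistance_nonneg _ _) (resistance_nonneg _ _)) fun f hf => ?_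
  rcases le_total (f z) (f p) with h | h
  · exact resistance_triangle_aux p q z hf h
  · rw [abs_sub_comm, add_comm, resistance_comm p q, resistance_comm q z]
    exact resistance_triangle_aux z q p hf h

instance (b : ℕ) [NeZero b] : PseudoMetricSpace (BubbleVertex b) where
  dist := resistance
  dist_self p := le_antisymm (resistance_le le_rfl fun f hf => by simp) (resistance_nonneg p p)
  dist_comm := resistance_comm
  dist_triangle := resistance_triangle

theorem dist_le_hundred {b : ℕ} [NeZero b] (p q : BubbleVertex b) : dist p q ≤ 100 :=
  csInf_le (resistance_bddBelow p q) (resistance_set_mem p q)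

theorem dist_vertexMap_le {b : ℕ} [NeZero b] (i : Fin (b + 2)) (p q : BubbleVertex b) :
    dist (vertexMap i p) (vertexMap i q) ≤ renorm b * dist p q := by
  have hr := renorm_pos b
  refine resistance_le (mul_nonneg hr.le dist_nonneg) fun f hf => ?_
  calc |f (vertexMap i p) - f (vertexMap i q)| ^ 2
      ≤ resistance p q * energy (f ∘ vertexMap i) := sq_le_resistance p q (hf.comp i)
    _ ≤ resistance p q * (renorm b * energy f) :=
        mul_le_mul_of_nonneg_left (energy_comp_le hf i) (resistance_nonneg p q)
    _ = renorm b * resistance p q * energy f := by ring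

theorem uniformContinuous_vertexMap {b : ℕ} [NeZero b] (i : Fin (b + 2)) :
    UniformContinuous (vertexMap i : BubbleVertex b → BubbleVertex b) :=
  (LipschitzWith.of_dist_le_mul (K := ⟨renorm b, (renorm_pos b).le⟩)
    fun p q => dist_vertexMap_le i p q).uniformContinuous

/-! ### The fractal and its self-similar measure -/

/-- The bubble-diamond fractal `K_b`: the completion of `V_*` in the resistance metric. -/
abbrev Fractal (b : ℕ) [NeZero b] : Type := UniformSpace.Completion (BubbleVertex b)

instance (b : ℕ) [NeZero b] : MeasurableSpace (Fractal b) := borel _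

instance (b : ℕ) [NeZero b] : BorelSpace (Fractal b) := ⟨rfl⟩

/-- The boundary points `q 0`, `q 1` in `K_b`. -/
def bdry (b : ℕ) [NeZero b] (n : Fin 2) : Fractal b := ((q n : BubbleVertex b) : Fractal b)

/-- The continuous extension `F_i : K_b → K_b`. -/
def fractalMap {b : ℕ} [NeZero b] (i : Fin (b + 2)) : Fractal b → Fractal b :=
  UniformSpace.Completion.map (vertexMap i)

theorem fractalMap_coe {b : ℕ} [NeZero b] (i : Fin (b + 2)) (p : BubbleVertex b) :
    fractalMap i (p : Fractal b) = (vertexMap i p : BubbleVertex b) :=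
  UniformSpace.Completion.map_coe (uniformContinuous_vertexMap i) p

theorem continuous_fractalMap {b : ℕ} [NeZero b] (i : Fin (b + 2)) :
    Continuous (fractalMap i : Fractal b → Fractal b) :=
  UniformSpace.Completion.continuous_map

/-- The defining properties of the self-similar measure: `μ(K_b) = 1` and
`μ(A) = (b + 2)⁻¹ ∑ i, μ(F_i⁻¹ A)`. -/
def IsSelfSimilar {b : ℕ} [NeZero b] (μ : Measure (Fractal b)) : Prop :=
  μ Set.univ = 1 ∧ ∀ A, MeasurableSet A →
    μ A = (b + 2 : ENNReal)⁻¹ * ∑ i : Fin (b + 2), μ (fractalMap i ⁻¹' A)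

/-- `F_{ω 0} ∘ ⋯ ∘ F_{ω (n-1)} (q 0)`. -/
def approx {b : ℕ} [NeZero b] : ℕ → (ℕ → Fin (b + 2)) → BubbleVertex b
  | 0, _ => q 0
  | n + 1, ω => vertexMap (ω 0) (approx n fun k => ω (k + 1))

theorem dist_approx {b : ℕ} [NeZero b] (n : ℕ) (ω : ℕ → Fin (b + 2)) :
    dist (approx n ω) (approx (n + 1) ω) ≤ 100 * renorm b ^ n := by
  induction n generalizing ω with
  | zero => simpa using dist_le_hundred _ _
  | succ n ih =>
    have h := ih fun k => ω (k + 1)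
    have hr := renorm_pos b
    calc _ ≤ renorm b * dist _ _ := dist_vertexMap_le _ _ _
      _ ≤ renorm b * (100 * renorm b ^ n) := mul_le_mul_of_nonneg_left h hr.le
      _ = _ := by ring

theorem exists_coding {b : ℕ} [NeZero b] (ω : ℕ → Fin (b + 2)) :
    ∃ x : Fractal b, Tendsto (fun n => (approx n ω : Fractal b)) atTop (𝓝 x) := by
  refine cauchySeq_tendsto_of_complete (cauchySeq_of_le_geometric (renorm b) 100 ?_ fun n => ?_)
  · linarith [renorm_lt_half b]
  · rw [UniformSpace.Completion.dist_eq]; exact dist_approx n ω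

theorem measurable_approx {b : ℕ} [NeZero b] (n : ℕ) :
    Measurable fun ω : ℕ → Fin (b + 2) => (approx n ω : Fractal b) := by
  induction n with
  | zero => exact (measurable_const (a := bdry b 0))
  | succ n ih =>
    have h : Measurable fun x : Fin (b + 2) × Fractal b => fractalMap x.1 x.2 :=
      measurable_from_prod_countable_right fun i => (continuous_fractalMap i).measurable
    have h2 : Measurable fun ω : ℕ → Fin (b + 2) =>
        (ω 0, ((approx n fun k => ω (k + 1) : BubbleVertex b) : Fractal b)) :=
      (measurable_pi_apply 0).prodMk
        (ih.comp (measurable_pi_lambda _ fun k => measurable_pi_apply (k + 1)))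
    simpa [Function.comp_def, fractalMap_coe, approx] using h.comp h2

theorem exists_isSelfSimilar (b : ℕ) [NeZero b] :
    ∃ μ : Measure (Fractal b), IsSelfSimilar μ := by
  choose π hπ using exists_coding (b := b)
  have hmeas : Measurable π := by
    refine measurable_of_tendsto_metrizable (f := fun n ω => (approx n ω : Fractal b))
      (fun n => measurable_approx n) ?_
    rw [tendsto_pi_nhds]; exact hπ
  let cons : Fin (b + 2) → (ℕ → Fin (b + 2)) → (ℕ → Fin (b + 2)) := fun i ω k => Nat.casesOn k i ω
  have hcons : ∀ i, Measurable (cons i) := fun i => measurable_pi_lambda _ fun k => by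
    cases k with
    | zero => exact measurable_const
    | succ k => exact measurable_pi_apply k
  have hπc : ∀ i ω, π (cons i ω) = fractalMap i (π ω) := fun i ω => by
    refine tendsto_nhds_unique ((tendsto_add_atTop_iff_nat 1).2 (hπ (cons i ω))) ?_
    have := ((continuous_fractalMap i).tendsto _).comp (hπ ω)
    simpa [Function.comp_def, fractalMap_coe, approx, cons] using this
  let u : Measure (Fin (b + 2)) := (b + 2 : ENNReal)⁻¹ • Measure.count
  have hu0 : (b + 2 : ENNReal) ≠ 0 := by simp
  have hut : (b + 2 : ENNReal) ≠ ⊤ := by finiteness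
  have : IsProbabilityMeasure u := ⟨by
    simp only [u, Measure.smul_apply, Measure.count_univ, smul_eq_mul]
    simp only [ENat.card_eq_coe_fintype_card, Fintype.card_fin]
    push_cast
    exact ENNReal.inv_mul_cancel hu0 hut⟩
  let P : Measure (ℕ → Fin (b + 2)) := Measure.infinitePi fun _ => u
  let Q : Measure (ℕ → Fin (b + 2)) := (b + 2 : ENNReal)⁻¹ • ∑ i, P.map (cons i)
  have hQP : Q = P := by
    refine Measure.eq_infinitePi _ fun s t ht => ?_
    classical
    obtain ⟨N, hN⟩ : ∃ N, s ⊆ Finset.range (N + 1) :=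
      ⟨s.sup id, fun x hx => Finset.mem_range.2
        (Nat.lt_succ_of_le (Finset.le_sup (f := id) hx))⟩
    let t' : ℕ → Set (Fin (b + 2)) := fun k => if k ∈ s then t k else Set.univ
    have h1 : (s : Set ℕ).pi t = (Finset.range (N + 1) : Set ℕ).pi t' := by
      ext ω
      simp only [Set.mem_pi, t']
      refine ⟨fun h k _ => ?_, fun h k hk => ?_⟩
      · split_ifs with hk
        · exact h k hk
        · trivial
      · have := h k (hN hk)
        rwa [if_pos (Finset.mem_coe.1 hk)] at this
    have h2 : ∏ i ∈ s, u (t i) = ∏ i ∈ Finset.range (N + 1), u (t' i) := by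
      rw [← Finset.prod_subset hN (f := fun i => u (t' i))]
      · exact Finset.prod_congr rfl fun i hi => by simp [t', hi]
      · intro x _ hx; simp [t', hx]
    have hpre : ∀ i, cons i ⁻¹' (Finset.range (N + 1) : Set ℕ).pi t' =
        if i ∈ t' 0 then (Finset.range N : Set ℕ).pi (fun k => t' (k + 1)) else ∅ := fun i => by
      ext ω
      have : ω ∈ cons i ⁻¹' (Finset.range (N + 1) : Set ℕ).pi t' ↔
          i ∈ t' 0 ∧ ω ∈ (Finset.range N : Set ℕ).pi (fun k => t' (k + 1)) := by
        simp only [Set.mem_preimage, Set.mem_pi, Finset.coe_range, Set.mem_Iio]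
        refine ⟨fun h => ⟨h 0 (by omega), fun k hk => h (k + 1) (by omega)⟩, fun h k hk => ?_⟩
        cases k with
        | zero => exact h.1
        | succ k => exact h.2 k (by omega)
      rw [this]; split_ifs with hi <;> simp [hi]
    have hm : MeasurableSet ((Finset.range (N + 1) : Set ℕ).pi t') :=
      MeasurableSet.pi (Finset.countable_toSet _) fun _ _ => MeasurableSet.of_discrete
    have hP : ∀ i, (P.map (cons i)) ((Finset.range (N + 1) : Set ℕ).pi t') =
        (if i ∈ t' 0 then 1 else 0) * ∏ k ∈ Finset.range N, u (t' (k + 1)) := fun i => by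
      rw [Measure.map_apply (hcons i) hm, hpre]
      split_ifs
      · rw [one_mul]
        exact Measure.infinitePi_pi _ fun _ _ => MeasurableSet.of_discrete
      · simp
    rw [h1, h2, Finset.prod_range_succ']
    simp only [Q, Measure.smul_apply, Measure.coe_finsetSum, Finset.sum_apply, hP, smul_eq_mul]
    rw [← Finset.sum_mul, ← mul_assoc, mul_comm]
    congr 1
    simp only [u, Measure.smul_apply, smul_eq_mul]
    congr 1
    rw [Measure.count_apply MeasurableSet.of_discrete, Set.encard_eq_coe_toFinset_card]
    simp [Finset.sum_boole, Set.toFinset]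
  refine ⟨P.map π, ?_, fun A hA => ?_⟩
  · rw [Measure.map_apply hmeas MeasurableSet.univ]; simp [P]
  · have e : ∀ i, (P.map π) (fractalMap i ⁻¹' A) = (P.map (cons i)) (π ⁻¹' A) := fun i => by
      rw [Measure.map_apply hmeas ((continuous_fractalMap i).measurable hA),
        Measure.map_apply (hcons i) (hmeas hA)]
      congr 1; ext ω; simp [hπc]
    simp only [e]
    rw [Measure.map_apply hmeas hA]
    conv_lhs => rw [← hQP]
    simp [Q]

/-- The self-similar measure `μ` on `K_b`. -/
def selfSimilarMeasure (b : ℕ) [NeZero b] : Measure (Fractal b) := (exists_isSelfSimilar b).choose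

theorem isSelfSimilar_selfSimilarMeasure (b : ℕ) [NeZero b] :
    IsSelfSimilar (selfSimilarMeasure b) := (exists_isSelfSimilar b).choose_spec

/-! ### The Laplacian and polynomials -/

/-- `u ∈ dom 𝓔`, for a continuous function `u` on `K_b`.  (A function of finite energy on `V_*` has
exactly one continuous extension to `K_b`.) -/
def InDomEnergy {b : ℕ} [NeZero b] (u : C(Fractal b, ℝ)) : Prop :=
  FiniteEnergy fun p : BubbleVertex b => u p

/-- The bilinear form `𝓔(u, g)`, by polarization. -/
def energyForm {b : ℕ} [NeZero b] (u g : C(Fractal b, ℝ)) : ℝ :=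
  (1 / 4) * (energy (fun p : BubbleVertex b => (u + g) p) -
    energy (fun p : BubbleVertex b => (u - g) p))

/-- `u ∈ dom Δ` with `Δ u = f`. -/
def HasLaplacian {b : ℕ} [NeZero b] (u f : C(Fractal b, ℝ)) : Prop :=
  InDomEnergy u ∧ ∀ g : C(Fractal b, ℝ), InDomEnergy g → (∀ n, g (bdry b n) = 0) →
    energyForm u g = -∫ x, f x * g x ∂(selfSimilarMeasure b)

/-- The domain of the Laplacian. -/
def domLaplacian (b : ℕ) [NeZero b] : Set C(Fractal b, ℝ) := {u | ∃ f, HasLaplacian u f}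

open Classical in
/-- The Laplacian `Δ u` of `u ∈ dom Δ` (and `0` off the domain). -/
def laplacian {b : ℕ} [NeZero b] (u : C(Fractal b, ℝ)) : C(Fractal b, ℝ) :=
  if h : ∃ f, HasLaplacian u f then h.choose else 0

/-- The space `𝓗_j` of polynomials of degree at most `j`: the functions `u` for which `Δ^{j+1} u` is
defined and equals `0`. -/
def polynomials (b : ℕ) [NeZero b] (j : ℕ) : Set C(Fractal b, ℝ) :=
  {u | (∀ m ≤ j, laplacian^[m] u ∈ domLaplacian b) ∧ laplacian^[j + 1] u = 0}

/-- `u` solves `Δ^{j+1} u = 0` with the boundary conditions `Δ^m u (q_n) = δ_{jm} δ_{kn}` for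
`0 ≤ m ≤ j` and `n ∈ {1, 2}`. -/
def IsBasicPolynomial {b : ℕ} [NeZero b] (j : ℕ) (k : Fin 2) (u : C(Fractal b, ℝ)) : Prop :=
  u ∈ polynomials b j ∧ ∀ m ≤ j, ∀ n : Fin 2,
    (laplacian^[m] u) (bdry b n) = (if m = j then 1 else 0) * (if n = k then 1 else 0)

end BubbleDiamond

end

/-! The fractal is $b+2$ copies of itself glued at vertices. Energy splits over the copies with
factor $r^{-1}$ (`energyForm_eq_sum`), integrals with factor $1/(b+2)$ (`integral_eq_sum`). Three
analytic facts follow.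

Uniqueness of $\Delta u$ (`HasLaplacian.unique`): a continuous $f$ orthogonal to all test functions
vanishes. Test functions can be transplanted into one cell, so orthogonality passes to $f\circ F_w$.
Zooming in at a boundary point, where $f$ is almost constant, gives $f(q_n)=0$; applied to every
$f\circ F_w$, this gives $f=0$ on $V_*$, which is dense.

Solvability (`exists_hasLaplacian`): for continuous $f$ and given boundary values, the minimizer of
$\mathcal E(u)+2\int uf\,d\mu$ solves $\Delta u=f$. The solution is unique because energy zero
forces a constant (`HasLaplacian.eq_zero`).

Scaling (`HasLaplacian.comp_cellMap`): $\Delta(u\circ F_i)=\frac r{b+2}(\Delta u)\circ F_i$.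

The rest is linear algebra. The map $u\mapsto(\Delta^m u(q_n))_{m\le j,\,n}$ is injective on
$\mathcal H_j$ by iterated uniqueness. Solving $\Delta f_{j+1,k}=f_{jk}$ with zero boundary values
yields functions dual to these functionals, hence a basis. Statement (b) is the expansion of
$f_{jk}\circ F_i\in\mathcal H_j$ in this basis, its coefficients computed by scaling and $\Delta^m
f_{jk}=f_{j-m,k}$. -/

namespace BubbleDiamond

open BubbleVertex

/-! ### The bilinear graph energy -/

/-- The bilinear form that belongs to the graph energy `levelEnergy l`. -/
noncomputable def levelForm {b : ℕ} (l : ℕ) (f g : BubbleVertex b → ℝ) : ℝ :=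
  (renorm b)⁻¹ ^ l * ∑ w : Fin l → Fin (b + 2),
    (f (endpoint (List.ofFn w) 0) - f (endpoint (List.ofFn w) 1)) *
      (g (endpoint (List.ofFn w) 0) - g (endpoint (List.ofFn w) 1))

theorem levelForm_self {b : ℕ} (l : ℕ) (f : BubbleVertex b → ℝ) :
    levelForm l f f = levelEnergy l f := by
  simp [levelForm, levelEnergy, sq]

theorem levelForm_comm {b : ℕ} (l : ℕ) (f g : BubbleVertex b → ℝ) :
    levelForm l f g = levelForm l g f := by
  simp [levelForm, mul_comm]

theorem levelForm_add_left {b : ℕ} (l : ℕ) (f f' g : BubbleVertex b → ℝ) :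
    levelForm l (f + f') g = levelForm l f g + levelForm l f' g := by
  simp only [levelForm, ← mul_add, ← Finset.sum_add_distrib, Pi.add_apply]
  congr 1
  exact Finset.sum_congr rfl fun w _ => by ring

theorem levelForm_smul_left {b : ℕ} (l : ℕ) (c : ℝ) (f g : BubbleVertex b → ℝ) :
    levelForm l (c • f) g = c * levelForm l f g := by
  simp only [levelForm, Finset.mul_sum, Pi.smul_apply, smul_eq_mul]
  exact Finset.sum_congr rfl fun w _ => by ring

theorem levelForm_succ {b : ℕ} (l : ℕ) (f g : BubbleVertex b → ℝ) :
    levelForm (l + 1) f g =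
      (renorm b)⁻¹ * ∑ i, levelForm l (f ∘ vertexMap i) (g ∘ vertexMap i) := by
  unfold levelForm
  rw [← Finset.mul_sum, ← mul_assoc, ← pow_succ', ← (Fin.consEquiv fun _ => Fin (b + 2)).sum_comp,
    Fintype.sum_prod_type]
  simp [endpoint, wordMap, Fin.consEquiv, List.ofFn_succ]

theorem levelEnergy_add {b : ℕ} (l : ℕ) (f g : BubbleVertex b → ℝ) :
    levelEnergy l (f + g) = levelEnergy l f + 2 * levelForm l f g + levelEnergy l g := by
  rw [← levelForm_self, levelForm_add_left, levelForm_comm l f, levelForm_comm l g,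
    levelForm_add_left, levelForm_add_left, levelForm_self, levelForm_self, levelForm_comm l g]
  ring

theorem levelEnergy_smul {b : ℕ} (l : ℕ) (c : ℝ) (f : BubbleVertex b → ℝ) :
    levelEnergy l (c • f) = c ^ 2 * levelEnergy l f := by
  rw [← levelForm_self, levelForm_smul_left, levelForm_comm, levelForm_smul_left, levelForm_self]
  ring

theorem levelEnergy_sub {b : ℕ} (l : ℕ) (f g : BubbleVertex b → ℝ) :
    levelEnergy l (f - g) = levelEnergy l f - 2 * levelForm l f g + levelEnergy l g := by
  have h : f - g = f + (-1 : ℝ) • g := by ext; simp [sub_eq_add_neg]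
  rw [h, levelEnergy_add, levelEnergy_smul, levelForm_comm, levelForm_smul_left, levelForm_comm]
  ring

/-- By the parallelogram law at each level, $\mathcal E_\ell(f+g)\le 2\mathcal E_\ell(f)+2\mathcal
E_\ell(g)$. -/
theorem FiniteEnergy.add {b : ℕ} [NeZero b] {f g : BubbleVertex b → ℝ} (hf : FiniteEnergy f)
    (hg : FiniteEnergy g) : FiniteEnergy (f + g) := by
  refine ⟨2 * energy f + 2 * energy g, ?_⟩
  rintro _ ⟨l, rfl⟩
  have h1 := levelEnergy_add l f g
  have h2 := levelEnergy_sub l f g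
  have h3 := levelEnergy_nonneg l (f - g)
  dsimp only
  linarith [levelEnergy_le_energy hf l, levelEnergy_le_energy hg l]

theorem FiniteEnergy.smul {b : ℕ} {f : BubbleVertex b → ℝ} (hf : FiniteEnergy f) (c : ℝ) :
    FiniteEnergy (c • f) := by
  refine ⟨c ^ 2 * energy f, ?_⟩
  rintro _ ⟨l, rfl⟩
  dsimp only
  rw [levelEnergy_smul]
  exact mul_le_mul_of_nonneg_left (levelEnergy_le_energy hf l) (sq_nonneg c)

theorem finiteEnergy_const {b : ℕ} (c : ℝ) : FiniteEnergy fun _ : BubbleVertex b => c :=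
  ⟨0, by rintro _ ⟨l, rfl⟩; simp [levelEnergy]⟩

/-- Used to glue functions of finite energy along cells. Monotonicity in the level replaces $\ell$
by $\ell+1$, so that level $0$ needs no separate treatment. -/
theorem finiteEnergy_of_comp {b : ℕ} [NeZero b] {f : BubbleVertex b → ℝ}
    (h : ∀ i, FiniteEnergy (f ∘ vertexMap i)) : FiniteEnergy f := by
  have hr := renorm_pos b
  refine ⟨(renorm b)⁻¹ * ∑ i, energy (f ∘ vertexMap i), ?_⟩
  rintro _ ⟨l, rfl⟩
  refine (levelEnergy_le_succ l f).trans ?_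
  rw [levelEnergy_succ]
  gcongr with i
  exact levelEnergy_le_energy (h i) l

/-- A function that varies less than a function of finite energy has finite energy. -/
theorem FiniteEnergy.of_abs_sub_le {b : ℕ} [NeZero b] {f g : BubbleVertex b → ℝ}
    (hf : FiniteEnergy f) (h : ∀ p q, |g p - g q| ≤ |f p - f q|) : FiniteEnergy g := by
  have hr := renorm_pos b
  refine ⟨energy f, ?_⟩
  rintro _ ⟨l, rfl⟩
  refine le_trans ?_ (levelEnergy_le_energy hf l)
  exact mul_le_mul_of_nonneg_left
    (Finset.sum_le_sum fun w _ => pow_le_pow_left₀ (abs_nonneg _) (h _ _) 2) (by positivity)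

/-! ### The energy form on the fractal -/

/-- The restriction to `V_*` of a continuous function on `K_b`. -/
noncomputable abbrev restr {b : ℕ} [NeZero b] (u : C(Fractal b, ℝ)) : BubbleVertex b → ℝ :=
  fun p => u (p : Fractal b)

/-- `dom 𝓔` as a vector space of continuous functions. -/
noncomputable def domEnergy (b : ℕ) [NeZero b] : Submodule ℝ C(Fractal b, ℝ) where
  carrier := {u | InDomEnergy u}
  add_mem' hu hv := FiniteEnergy.add hu hv
  zero_mem' := finiteEnergy_const 0
  smul_mem' c _ hu := FiniteEnergy.smul hu c

theorem mem_domEnergy {b : ℕ} [NeZero b] {u : C(Fractal b, ℝ)} :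
    u ∈ domEnergy b ↔ InDomEnergy u := Iff.rfl

/-- The polarized form is the limit of the level forms. Bilinearity and self-similarity of
`energyForm` are then obtained as limits of finite-sum identities. -/
theorem tendsto_levelForm {b : ℕ} [NeZero b] {u g : C(Fractal b, ℝ)} (hu : InDomEnergy u)
    (hg : InDomEnergy g) :
    Tendsto (fun l => levelForm l (restr u) (restr g)) atTop (𝓝 (energyForm u g)) := by
  have h1 := tendsto_levelEnergy (mem_domEnergy.1 ((domEnergy b).add_mem hu hg))
  have h2 := tendsto_levelEnergy (mem_domEnergy.1 ((domEnergy b).sub_mem hu hg))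
  refine ((h1.sub h2).const_mul (1 / 4)).congr fun l => ?_
  have e1 := levelEnergy_add l (restr u) (restr g)
  have e2 := levelEnergy_sub l (restr u) (restr g)
  change 1 / 4 * (levelEnergy l (restr u + restr g) - levelEnergy l (restr u - restr g)) = _
  rw [e1, e2]; ring

theorem energyForm_self {b : ℕ} [NeZero b] {u : C(Fractal b, ℝ)} (hu : InDomEnergy u) :
    energyForm u u = energy (restr u) :=
  tendsto_nhds_unique (tendsto_levelForm hu hu)
    ((tendsto_levelEnergy hu).congr fun l => (levelForm_self l _).symm)

theorem energyForm_add_left {b : ℕ} [NeZero b] {u v g : C(Fractal b, ℝ)} (hu : InDomEnergy u)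
    (hv : InDomEnergy v) (hg : InDomEnergy g) :
    energyForm (u + v) g = energyForm u g + energyForm v g :=
  tendsto_nhds_unique (tendsto_levelForm (mem_domEnergy.1 ((domEnergy b).add_mem hu hv)) hg)
    (((tendsto_levelForm hu hg).add (tendsto_levelForm hv hg)).congr fun l =>
      (levelForm_add_left l _ _ _).symm)

theorem energyForm_smul_left {b : ℕ} [NeZero b] {u g : C(Fractal b, ℝ)} (c : ℝ)
    (hu : InDomEnergy u) (hg : InDomEnergy g) : energyForm (c • u) g = c * energyForm u g :=
  tendsto_nhds_unique (tendsto_levelForm (mem_domEnergy.1 ((domEnergy b).smul_mem c hu)) hg)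
    (((tendsto_levelForm hu hg).const_mul c).congr fun l => (levelForm_smul_left l _ _ _).symm)

theorem energy_add_smul {b : ℕ} [NeZero b] {u g : C(Fractal b, ℝ)} (t : ℝ)
    (hu : InDomEnergy u) (hg : InDomEnergy g) :
    energy (restr (u + t • g)) =
      energy (restr u) + 2 * t * energyForm u g + t ^ 2 * energy (restr g) := by
  have hg' := (domEnergy b).smul_mem t (mem_domEnergy.2 hg)
  refine tendsto_nhds_unique
    (tendsto_levelEnergy (mem_domEnergy.1 ((domEnergy b).add_mem hu hg'))) ?_
  refine (((tendsto_levelEnergy hu).add ((tendsto_levelForm hu hg).const_mul (2 * t))).add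
    ((tendsto_levelEnergy hg).const_mul (t ^ 2))).congr fun l => ?_
  change _ = levelEnergy l (restr u + t • restr g)
  rw [levelEnergy_add, levelEnergy_smul, levelForm_comm l _ (t • _), levelForm_smul_left,
    levelForm_comm]
  ring

theorem energy_parallelogram {b : ℕ} [NeZero b] {u v : C(Fractal b, ℝ)} (hu : InDomEnergy u)
    (hv : InDomEnergy v) :
    energy (restr (u - v)) + energy (restr (u + v)) =
      2 * energy (restr u) + 2 * energy (restr v) := by
  have h1 := energy_add_smul 1 hu hv
  have h2 := energy_add_smul (-1) hu hv
  rw [one_smul] at h1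
  rw [neg_one_smul, ← sub_eq_add_neg] at h2
  rw [h1, h2]; ring

theorem energy_smul {b : ℕ} [NeZero b] {u : C(Fractal b, ℝ)} (c : ℝ) (hu : InDomEnergy u) :
    energy (restr (c • u)) = c ^ 2 * energy (restr u) :=
  tendsto_nhds_unique (tendsto_levelEnergy (mem_domEnergy.1 ((domEnergy b).smul_mem c hu)))
    (((tendsto_levelEnergy hu).const_mul (c ^ 2)).congr fun l => (levelEnergy_smul l c _).symm)

/-- Two continuous functions that agree on `V_*` are equal. -/
theorem ext_restr {b : ℕ} [NeZero b] {u v : C(Fractal b, ℝ)}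
    (h : ∀ p : BubbleVertex b, u (p : Fractal b) = v (p : Fractal b)) : u = v := by
  ext x
  induction x using UniformSpace.Completion.induction_on with
  | hp => exact isClosed_eq u.continuous v.continuous
  | ih p => exact h p

theorem FiniteEnergy.exists_extension {b : ℕ} [NeZero b] {f : BubbleVertex b → ℝ}
    (hf : FiniteEnergy f) : ∃ u : C(Fractal b, ℝ), ∀ p : BubbleVertex b, u (p : Fractal b) = f p := by
  have huc : UniformContinuous f := by
    rw [Metric.uniformContinuous_iff]
    intro ε hε
    have hE := energy_nonneg f
    -- The defining inequality of the resistance metric makes $f$ Hölder of exponent $1/2$; the $+1$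
    -- avoids division by zero energy.
    refine ⟨ε ^ 2 / (energy f + 1), by positivity, fun {p q} hpq => ?_⟩
    have h := sq_le_resistance p q hf
    rw [lt_div_iff₀ (by positivity)] at hpq
    have h0 : (0 : ℝ) ≤ dist p q := dist_nonneg
    have h1 : |f p - f q| ^ 2 ≤ dist p q * energy f := h
    rw [Real.dist_eq]
    refine lt_of_pow_lt_pow_left₀ 2 hε.le ?_
    nlinarith
  exact ⟨⟨UniformSpace.Completion.extension f, UniformSpace.Completion.continuous_extension⟩,
    fun p => UniformSpace.Completion.extension_coe huc p⟩

/-- Energy controls the uniform norm. This gives definiteness of the form as well as coercivity and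
uniform convergence in the Dirichlet problem. -/
theorem abs_sub_bdry_le {b : ℕ} [NeZero b] {u : C(Fractal b, ℝ)} (hu : InDomEnergy u)
    (x : Fractal b) : |u x - u (bdry b 0)| ≤ 5 * √(energy (restr u)) := by
  induction x using UniformSpace.Completion.induction_on with
  | hp => exact isClosed_le (by fun_prop) continuous_const
  | ih p => exact abs_sub_root_le hu p

theorem eq_zero_of_energy_eq_zero {b : ℕ} [NeZero b] {u : C(Fractal b, ℝ)} (hu : InDomEnergy u)
    (h : energy (restr u) = 0) (h0 : u (bdry b 0) = 0) : u = 0 := by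
  ext x
  have := abs_sub_bdry_le hu x
  rw [h, h0, Real.sqrt_zero, mul_zero, sub_zero] at this
  simpa using abs_nonpos_iff.1 this

/-! ### Self-similarity -/

/-- `F_i` as a bundled continuous map. -/
noncomputable def cellMap {b : ℕ} [NeZero b] (i : Fin (b + 2)) : C(Fractal b, Fractal b) :=
  ⟨fractalMap i, continuous_fractalMap i⟩

theorem cellMap_apply {b : ℕ} [NeZero b] (i : Fin (b + 2)) (x : Fractal b) :
    cellMap i x = fractalMap i x := rfl

theorem restr_comp_cellMap {b : ℕ} [NeZero b] (u : C(Fractal b, ℝ)) (i : Fin (b + 2)) :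
    restr (u.comp (cellMap i)) = restr u ∘ vertexMap i := by
  ext p
  simp [cellMap_apply, fractalMap_coe]

theorem InDomEnergy.comp {b : ℕ} [NeZero b] {u : C(Fractal b, ℝ)} (hu : InDomEnergy u)
    (i : Fin (b + 2)) : InDomEnergy (u.comp (cellMap i)) := by
  change FiniteEnergy (restr _)
  rw [restr_comp_cellMap]
  exact FiniteEnergy.comp hu i

theorem energyForm_eq_sum {b : ℕ} [NeZero b] {u g : C(Fractal b, ℝ)} (hu : InDomEnergy u)
    (hg : InDomEnergy g) : energyForm u g =
      (renorm b)⁻¹ * ∑ i, energyForm (u.comp (cellMap i)) (g.comp (cellMap i)) := by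
  refine tendsto_nhds_unique ((tendsto_add_atTop_iff_nat 1).2 (tendsto_levelForm hu hg)) ?_
  refine ((tendsto_finsetSum Finset.univ fun i _ =>
    tendsto_levelForm (hu.comp i) (hg.comp i)).const_mul (renorm b)⁻¹).congr fun l => ?_
  simp only [restr_comp_cellMap, levelForm_succ]

/-! ### Covering by small cells and compactness -/

theorem exists_vertexMap_eq {b : ℕ} [NeZero b] (p : BubbleVertex b) :
    ∃ i p', vertexMap i p' = p := by
  have hb := Nat.pos_of_ne_zero (NeZero.ne b)
  match p with
  | .mid [] n =>
    refine ⟨⟨0, by omega⟩, q n, ?_⟩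
    simp [vertexMap, hb.ne]
  | .mid (i :: w) n => exact ⟨i, mid w n, rfl⟩
  | .q n =>
    fin_cases n
    · exact ⟨⟨b, by omega⟩, q 0, by simp [vertexMap]⟩
    · exact ⟨⟨b + 1, by omega⟩, q 1, by simp [vertexMap]⟩

theorem dist_wordMap_le {b : ℕ} [NeZero b] (w : List (Fin (b + 2))) (p q : BubbleVertex b) :
    dist (wordMap w p) (wordMap w q) ≤ renorm b ^ w.length * dist p q := by
  have hr := renorm_pos b
  induction w with
  | nil => simp [wordMap]
  | cons i w ih =>
    calc _ ≤ renorm b * dist _ _ := dist_vertexMap_le _ _ _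
      _ ≤ renorm b * (renorm b ^ w.length * dist p q) := mul_le_mul_of_nonneg_left ih hr.le
      _ = _ := by rw [List.length_cons]; ring

theorem exists_wordMap_eq {b : ℕ} [NeZero b] (l : ℕ) (p : BubbleVertex b) :
    ∃ w : List (Fin (b + 2)), w.length = l ∧ ∃ p', wordMap w p' = p := by
  induction l generalizing p with
  | zero => exact ⟨[], rfl, p, rfl⟩
  | succ l ih =>
    obtain ⟨i, p', rfl⟩ := exists_vertexMap_eq p
    obtain ⟨w, hw, p'', rfl⟩ := ih p'
    exact ⟨i :: w, by simp [hw], p'', rfl⟩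

theorem tendsto_renorm_pow (b : ℕ) [NeZero b] :
    Tendsto (fun l => renorm b ^ l * 100) atTop (𝓝 0) := by
  simpa using (tendsto_pow_atTop_nhds_zero_of_lt_one (renorm_pos b).le
    (by linarith [renorm_lt_half b])).mul_const 100

/-- The finitely many cells of level $l$ cover $V_*$ and have diameter at most $100\,r^l$. -/
theorem totallyBounded_univ_bubbleVertex (b : ℕ) [NeZero b] :
    TotallyBounded (Set.univ : Set (BubbleVertex b)) := by
  rw [Metric.totallyBounded_iff]
  intro ε hε
  obtain ⟨l, hl⟩ := ((tendsto_renorm_pow b).eventually (gt_mem_nhds hε)).exists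
  refine ⟨(fun w => wordMap w (q 0)) '' {w : List (Fin (b + 2)) | w.length = l},
    (List.finite_length_eq _ l).image _, fun p _ => ?_⟩
  obtain ⟨w, hw, p', rfl⟩ := exists_wordMap_eq l p
  simp only [Set.mem_iUnion]
  refine ⟨_, ⟨w, hw, rfl⟩, ?_⟩
  rw [Metric.mem_ball]
  refine (dist_wordMap_le w _ _).trans_lt (lt_of_le_of_lt ?_ hl)
  rw [hw]
  exact mul_le_mul_of_nonneg_left (dist_le_hundred _ _) (pow_nonneg (renorm_pos b).le _)

instance (b : ℕ) [NeZero b] : CompactSpace (Fractal b) := by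
  refine ⟨isCompact_iff_totallyBounded_isComplete.2
    ⟨?_, completeSpace_iff_isComplete_univ.1 inferInstance⟩⟩
  have h := ((totallyBounded_univ_bubbleVertex b).image
    (UniformSpace.Completion.uniformContinuous_coe (BubbleVertex b))).closure
  rwa [Set.image_univ, UniformSpace.Completion.denseRange_coe.closure_range] at h

/-! ### Integration against the self-similar measure -/

instance (b : ℕ) [NeZero b] : IsProbabilityMeasure (selfSimilarMeasure b) :=
  ⟨(isSelfSimilar_selfSimilarMeasure b).1⟩

theorem integrable_selfSimilarMeasure {b : ℕ} [NeZero b] (f : C(Fractal b, ℝ)) :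
    Integrable (fun x => f x) (selfSimilarMeasure b) :=
  f.continuous.integrable_of_hasCompactSupport (HasCompactSupport.of_compactSpace _)

theorem integral_eq_sum {b : ℕ} [NeZero b] (f : C(Fractal b, ℝ)) :
    ∫ x, f x ∂(selfSimilarMeasure b) =
      (b + 2 : ℝ)⁻¹ * ∑ i, ∫ x, f (fractalMap i x) ∂(selfSimilarMeasure b) := by
  have hm : ∀ i : Fin (b + 2), Measurable (fractalMap i : Fractal b → Fractal b) :=
    fun i => (continuous_fractalMap i).measurable
  have h : selfSimilarMeasure b = (b + 2 : ENNReal)⁻¹ •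
      ∑ i : Fin (b + 2), (selfSimilarMeasure b).map (fractalMap i) := by
    ext A hA
    rw [(isSelfSimilar_selfSimilarMeasure b).2 A hA]
    simp [Measure.map_apply (hm _) hA]
  have e : (b + 2 : ENNReal).toReal = (b + 2 : ℝ) := by
    rw [ENNReal.toReal_add (by finiteness) (by finiteness)]; simp
  conv_lhs => rw [h]
  rw [integral_smul_measure, ENNReal.toReal_inv, e, smul_eq_mul, integral_finsetSum_measure]
  · congr 1
    refine Finset.sum_congr rfl fun i _ => ?_
    exact integral_map (hm i).aemeasurable f.continuous.aestronglyMeasurable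
  · intro i _
    rw [integrable_map_measure f.continuous.aestronglyMeasurable (hm i).aemeasurable]
    exact integrable_selfSimilarMeasure (f.comp (cellMap i))

/-! ### Functions supported in one cell -/

/-- The function that is `g ∘ F_i⁻¹` on the cell `i` and `0` elsewhere, for `g` that vanishes on the
boundary. -/
def extendByZero {b : ℕ} (i : Fin (b + 2)) (g : BubbleVertex b → ℝ) : BubbleVertex b → ℝ
  | .q _ => 0
  | .mid [] _ => 0
  | .mid (k :: w) n => if k = i then g (mid w n) else 0

theorem extendByZero_vertexMap {b : ℕ} (i k : Fin (b + 2)) {g : BubbleVertex b → ℝ}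
    (hg : ∀ n, g (q n) = 0) (p : BubbleVertex b) :
    extendByZero i g (vertexMap k p) = if k = i then g p else 0 := by
  cases p with
  | q n => simp only [vertexMap]; split_ifs <;> simp [extendByZero, hg]
  | mid w n => rfl

/-- The vanishing of $g$ at the boundary makes the gluing consistent at the vertices shared by
cells. Testing against $G$ turns a global weak identity into one on cell $i$. -/
theorem exists_extendByZero {b : ℕ} [NeZero b] (i : Fin (b + 2)) {g : C(Fractal b, ℝ)}
    (hg : InDomEnergy g) (h0 : ∀ n, g (bdry b n) = 0) :
    ∃ G : C(Fractal b, ℝ), InDomEnergy G ∧ (∀ n, G (bdry b n) = 0) ∧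
      ∀ k, G.comp (cellMap k) = if k = i then g else 0 := by
  have hk : ∀ k, extendByZero i (restr g) ∘ vertexMap k = if k = i then restr g else 0 := by
    intro k
    ext p
    rw [Function.comp, extendByZero_vertexMap i k h0]
    split_ifs <;> rfl
  have hE : FiniteEnergy (extendByZero i (restr g)) := finiteEnergy_of_comp fun k => by
    rw [hk]
    split_ifs
    · exact hg
    · exact finiteEnergy_const 0
  obtain ⟨G, hG⟩ := hE.exists_extension
  have hG' : restr G = extendByZero i (restr g) := funext hG
  refine ⟨G, ?_, fun n => hG (q n), fun k => ext_restr fun p => ?_⟩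
  · change FiniteEnergy (restr G)
    rwa [hG']
  · change restr (G.comp (cellMap k)) p = _
    rw [restr_comp_cellMap, hG', hk]
    split_ifs <;> rfl

theorem energyForm_zero_right {b : ℕ} [NeZero b] (u : C(Fractal b, ℝ)) :
    energyForm u 0 = 0 := by
  simp [energyForm]

theorem energyForm_extendByZero {b : ℕ} [NeZero b] {i : Fin (b + 2)} {u g G : C(Fractal b, ℝ)}
    (hu : InDomEnergy u) (hG : InDomEnergy G)
    (h : ∀ k, G.comp (cellMap k) = if k = i then g else 0) :
    energyForm u G = (renorm b)⁻¹ * energyForm (u.comp (cellMap i)) g := by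
  rw [energyForm_eq_sum hu hG, Finset.sum_eq_single i]
  · rw [h, if_pos rfl]
  · intro k _ hk
    rw [h, if_neg hk, energyForm_zero_right]
  · simp

theorem integral_extendByZero {b : ℕ} [NeZero b] {i : Fin (b + 2)} (f : C(Fractal b, ℝ))
    {g G : C(Fractal b, ℝ)} (h : ∀ k, G.comp (cellMap k) = if k = i then g else 0) :
    ∫ x, f x * G x ∂(selfSimilarMeasure b) =
      (b + 2 : ℝ)⁻¹ * ∫ x, f.comp (cellMap i) x * g x ∂(selfSimilarMeasure b) := by
  have h' : ∀ k x, G (fractalMap k x) = if k = i then g x else 0 := by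
    intro k x
    have := DFunLike.congr_fun (h k) x
    rw [ContinuousMap.comp_apply, cellMap_apply] at this
    rw [this]
    split_ifs <;> rfl
  have := integral_eq_sum (f * G)
  simp only [ContinuousMap.mul_apply, h'] at this
  rw [this, Finset.sum_eq_single i]
  · simp [cellMap_apply]
  · intro k _ hk
    simp [hk]
  · simp

/-- Testing $u$ against the transplant of $g$ into cell $i$ gives $r^{-1}\mathcal E(u\circ
F_i,g)=-\frac1{b+2}\int (f\circ F_i)\,g\,d\mu$. -/
theorem HasLaplacian.comp_cellMap {b : ℕ} [NeZero b] {u f : C(Fractal b, ℝ)}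
    (h : HasLaplacian u f) (i : Fin (b + 2)) :
    HasLaplacian (u.comp (cellMap i)) ((renorm b / (b + 2)) • f.comp (cellMap i)) := by
  refine ⟨h.1.comp i, fun g hg h0 => ?_⟩
  obtain ⟨G, hG, hG0, hGk⟩ := exists_extendByZero i hg h0
  have key := h.2 G hG hG0
  rw [energyForm_extendByZero h.1 hG hGk, integral_extendByZero f hGk] at key
  have hr := (renorm_pos b).ne'
  rw [inv_mul_eq_iff_eq_mul₀ hr] at key
  rw [key]
  simp only [ContinuousMap.smul_apply, smul_eq_mul, mul_assoc, integral_const_mul]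
  ring

/-! ### The harmonic function with boundary values `0` and `1` -/

/-- The harmonic function on `V_*` with boundary values `0` and `1`. -/
noncomputable def ramp {b : ℕ} : BubbleVertex b → ℝ
  | .q n => if n = 0 then 0 else 1
  | .mid [] n => if n = 0 then renorm b else 1 - renorm b
  | .mid (i :: w) n =>
      if (i : ℕ) = b then renorm b * ramp (mid w n)
      else if (i : ℕ) = b + 1 then 1 - renorm b + renorm b * ramp (mid w n)
      else renorm b + (1 - 2 * renorm b) * ramp (mid w n)

/-- The affine recursion also holds at the end points $q_n$: the three affine maps agree where cells
meet. -/
theorem ramp_vertexMap {b : ℕ} (i : Fin (b + 2)) (p : BubbleVertex b) :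
    ramp (vertexMap i p) =
      if (i : ℕ) = b then renorm b * ramp p
      else if (i : ℕ) = b + 1 then 1 - renorm b + renorm b * ramp p
      else renorm b + (1 - 2 * renorm b) * ramp p := by
  cases p with
  | q n =>
    obtain rfl | rfl : n = 0 ∨ n = 1 := by omega
    all_goals
      by_cases h1 : (i : ℕ) = b
      · simp [vertexMap, ramp, h1]
      by_cases h2 : (i : ℕ) = b + 1
      · simp [vertexMap, ramp, h2]
      · simp [vertexMap, ramp, h1, h2]
        try ring
  | mid w n => simp only [vertexMap, ramp]

/-- On each cell the function is an affine image of itself, so the induction reduces to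
$r^{-1}\bigl(b(1-2r)^2+2r^2\bigr)=1$. -/
theorem levelEnergy_ramp {b : ℕ} [NeZero b] (l : ℕ) :
    levelEnergy l (ramp : BubbleVertex b → ℝ) = 1 := by
  have hb : (0 : ℝ) < b := by exact_mod_cast Nat.pos_of_ne_zero (NeZero.ne b)
  have affine : ∀ (l : ℕ) (c d : ℝ), levelEnergy l (fun p : BubbleVertex b => d + c * ramp p) =
      c ^ 2 * levelEnergy l (ramp : BubbleVertex b → ℝ) := fun l c d => by
    simp only [levelEnergy, sq_abs, Finset.mul_sum]
    exact Finset.sum_congr rfl fun w _ => by ring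
  induction l with
  | zero => rw [levelEnergy_zero]; simp [ramp]
  | succ l ih =>
    have h : ∀ i : Fin (b + 2), levelEnergy l (ramp ∘ vertexMap i) =
        if (i : ℕ) = b ∨ (i : ℕ) = b + 1 then renorm b ^ 2 else (1 - 2 * renorm b) ^ 2 := by
      intro i
      by_cases h1 : (i : ℕ) = b
      · have e : ramp ∘ vertexMap i = fun p : BubbleVertex b => 0 + renorm b * ramp p := by
          ext p; simp [ramp_vertexMap, h1]
        rw [e, affine, ih, mul_one, if_pos (Or.inl h1)]
      by_cases h2 : (i : ℕ) = b + 1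
      · have e : ramp ∘ vertexMap i =
            fun p : BubbleVertex b => 1 - renorm b + renorm b * ramp p := by
          ext p; simp [ramp_vertexMap, h2]
        rw [e, affine, ih, mul_one, if_pos (Or.inr h2)]
      · have e : ramp ∘ vertexMap i =
            fun p : BubbleVertex b => renorm b + (1 - 2 * renorm b) * ramp p := by
          ext p; simp [ramp_vertexMap, h1, h2]
        rw [e, affine, ih, mul_one, if_neg (by tauto)]
    have hx : ∀ x : Fin b, (x : ℕ) ≠ b ∧ (x : ℕ) ≠ b + 1 := fun x => by omega
    rw [levelEnergy_succ]
    simp only [h, Fin.sum_univ_castSucc, Fin.val_castSucc, Fin.val_last, (hx _).1, (hx _).2]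
    simp only [or_self, if_false, Finset.sum_const, Finset.card_univ, Fintype.card_fin,
      nsmul_eq_mul, true_or, or_true, if_true]
    unfold renorm
    field_simp
    ring

theorem finiteEnergy_ramp {b : ℕ} [NeZero b] : FiniteEnergy (ramp : BubbleVertex b → ℝ) :=
  ⟨1, by rintro _ ⟨l, rfl⟩; exact (levelEnergy_ramp l).le⟩

theorem ramp_mem {b : ℕ} [NeZero b] (p : BubbleVertex b) : 0 ≤ ramp p ∧ ramp p ≤ 1 := by
  have hr := renorm_pos b
  have hr2 := renorm_lt_half b
  have step : ∀ (i : Fin (b + 2)) (p : BubbleVertex b), 0 ≤ ramp p ∧ ramp p ≤ 1 →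
      0 ≤ ramp (vertexMap i p) ∧ ramp (vertexMap i p) ≤ 1 := by
    rintro i p ⟨h0, h1⟩
    rw [ramp_vertexMap]
    split_ifs <;> constructor <;> nlinarith
  cases p with
  | q n => fin_cases n <;> simp [ramp]
  | mid w n =>
    induction w with
    | nil => fin_cases n <;> simp [ramp] <;> constructor <;> linarith
    | cons i w ih => exact step i _ ih

theorem exists_inDomEnergy_bdry {b : ℕ} [NeZero b] (a : Fin 2 → ℝ) :
    ∃ u : C(Fractal b, ℝ), InDomEnergy u ∧ ∀ n, u (bdry b n) = a n := by
  have hE : FiniteEnergy ((fun _ : BubbleVertex b => a 0) + (a 1 - a 0) • ramp) :=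
    (finiteEnergy_const _).add (finiteEnergy_ramp.smul _)
  obtain ⟨u, hu⟩ := hE.exists_extension
  have hu' : restr u = _ := funext hu
  refine ⟨u, ?_, fun n => ?_⟩
  · change FiniteEnergy (restr u)
    rwa [hu']
  · refine (hu (q n)).trans ?_
    fin_cases n <;> simp [ramp]

/-- There is a test function with positive integral. -/
theorem exists_integral_pos (b : ℕ) [NeZero b] :
    ∃ g : C(Fractal b, ℝ), InDomEnergy g ∧ (∀ n, g (bdry b n) = 0) ∧ (∀ x, 0 ≤ g x) ∧
      0 < ∫ x, g x ∂(selfSimilarMeasure b) := by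
  have hr := renorm_pos b
  have hr2 := renorm_lt_half b
  -- With $h$ the harmonic ramp, the test function is $h(1-h)$: it vanishes at both boundary points,
  -- and $x\mapsto x(1-x)$ is $1$-Lipschitz on $[0,1]$.
  have hE : FiniteEnergy fun p : BubbleVertex b => ramp p * (1 - ramp p) :=
    finiteEnergy_ramp.of_abs_sub_le fun p q => by
      have hp := ramp_mem p
      have hq := ramp_mem q
      have e : ramp p * (1 - ramp p) - ramp q * (1 - ramp q) =
        (ramp p - ramp q) * (1 - ramp p - ramp q) := by ring
      rw [e, abs_mul]
      refine mul_le_of_le_one_right (abs_nonneg _) (abs_le.2 ⟨?_, ?_⟩) <;> linarith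
  obtain ⟨g, hg⟩ := hE.exists_extension
  have hg' : restr g = _ := funext hg
  have g0 : ∀ x, 0 ≤ g x := fun x => by
    induction x using UniformSpace.Completion.induction_on with
    | hp => exact isClosed_le continuous_const g.continuous
    | ih p =>
      rw [hg]
      have := ramp_mem p
      nlinarith
  refine ⟨g, ?_, fun n => ?_, g0, ?_⟩
  · change FiniteEnergy (restr g)
    rwa [hg']
  · refine (hg (q n)).trans ?_
    fin_cases n <;> simp [ramp]
  · have hb := Nat.pos_of_ne_zero (NeZero.ne b)
    let i : Fin (b + 2) := ⟨0, by omega⟩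
    -- On a middle cell $r\le h\le 1-r$, so $h(1-h)\ge r^2$.
    have gi : ∀ x, renorm b * renorm b ≤ g (fractalMap i x) := fun x => by
      induction x using UniformSpace.Completion.induction_on with
      | hp => exact isClosed_le continuous_const (g.continuous.comp (continuous_fractalMap i))
      | ih p =>
        have hp := ramp_mem p
        rw [fractalMap_coe, hg, ramp_vertexMap, if_neg (by simp [i, hb.ne]),
          if_neg (by simp [i])]
        refine mul_le_mul ?_ ?_ hr.le ?_ <;> nlinarith
    rw [integral_eq_sum]
    refine mul_pos (by positivity) ?_
    refine Finset.sum_pos' (fun k _ => integral_nonneg fun x => g0 _) ⟨i, Finset.mem_univ _, ?_⟩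
    have h1 : ∫ _, renorm b * renorm b ∂(selfSimilarMeasure b) ≤
        ∫ x, g (fractalMap i x) ∂(selfSimilarMeasure b) :=
      integral_mono (integrable_const _)
        (integrable_selfSimilarMeasure (g.comp (cellMap i))) gi
    rw [integral_const] at h1
    simp only [probReal_univ, one_smul] at h1
    exact lt_of_lt_of_le (by positivity) h1

/-! ### Uniqueness of the Laplacian -/

/-- `f` is orthogonal to all test functions. -/
def IsAnnihilator {b : ℕ} [NeZero b] (f : C(Fractal b, ℝ)) : Prop :=
  ∀ g : C(Fractal b, ℝ), InDomEnergy g → (∀ n, g (bdry b n) = 0) →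
    ∫ x, f x * g x ∂(selfSimilarMeasure b) = 0

theorem IsAnnihilator.comp_cellMap {b : ℕ} [NeZero b] {f : C(Fractal b, ℝ)}
    (hf : IsAnnihilator f) (i : Fin (b + 2)) : IsAnnihilator (f.comp (cellMap i)) := by
  intro g hg h0
  obtain ⟨G, hG, hG0, hGk⟩ := exists_extendByZero i hg h0
  have := hf G hG hG0
  rw [integral_extendByZero f hGk] at this
  exact (mul_eq_zero.1 this).resolve_left (by positivity)

theorem IsAnnihilator.exists_comp_wordMap {b : ℕ} [NeZero b] {f : C(Fractal b, ℝ)}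
    (hf : IsAnnihilator f) (w : List (Fin (b + 2))) :
    ∃ f' : C(Fractal b, ℝ), IsAnnihilator f' ∧
      ∀ p : BubbleVertex b, f' (p : Fractal b) = f (wordMap w p : BubbleVertex b) := by
  induction w generalizing f with
  | nil => exact ⟨f, hf, fun p => rfl⟩
  | cons i w ih =>
    obtain ⟨f', h1, h2⟩ := ih (hf.comp_cellMap i)
    refine ⟨f', h1, fun p => ?_⟩
    rw [h2, ContinuousMap.comp_apply, cellMap_apply, fractalMap_coe, wordMap]

/-- Some $F_i$ fixes $q_n$, and the cells $F_i^l(K_b)$ shrink to $q_n$. So $f\circ F_i^l$ is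
uniformly $\varepsilon$-close to the constant $f(q_n)$ while still annihilating test functions; a
test function $g\ge0$ with positive integral yields $|f(q_n)|\int g\,d\mu\le\varepsilon\int
g\,d\mu$. -/
theorem IsAnnihilator.bdry_eq_zero {b : ℕ} [NeZero b] {f : C(Fractal b, ℝ)}
    (hf : IsAnnihilator f) (n : Fin 2) : f (bdry b n) = 0 := by
  obtain ⟨i, hi⟩ : ∃ i : Fin (b + 2), vertexMap i (q n) = q n := by
    fin_cases n
    · exact ⟨⟨b, by omega⟩, by simp [vertexMap]⟩
    · exact ⟨⟨b + 1, by omega⟩, by simp [vertexMap]⟩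
  have hw : ∀ l, wordMap (List.replicate l i) (q n) = q n := fun l => by
    induction l with
    | zero => rfl
    | succ l ih => rw [List.replicate_succ, wordMap, ih, hi]
  refine abs_eq_zero.1 (le_antisymm (le_of_forall_pos_le_add fun ε hε => ?_) (abs_nonneg _))
  rw [zero_add]
  obtain ⟨δ, hδ, hfδ⟩ := Metric.continuous_iff.1 f.continuous (bdry b n) ε hε
  obtain ⟨l, hl⟩ := ((tendsto_renorm_pow b).eventually (gt_mem_nhds hδ)).exists
  obtain ⟨f', hf', hff'⟩ := hf.exists_comp_wordMap (List.replicate l i)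
  have hclose : ∀ x, |f (bdry b n) - f' x| ≤ ε := fun x => by
    induction x using UniformSpace.Completion.induction_on with
    | hp => exact isClosed_le (by fun_prop) continuous_const
    | ih p =>
      rw [hff', abs_sub_comm, ← Real.dist_eq]
      refine (hfδ _ ?_).le
      rw [bdry, UniformSpace.Completion.dist_eq]
      have hd := dist_wordMap_le (List.replicate l i) p (q n)
      rw [hw] at hd
      refine hd.trans_lt (lt_of_le_of_lt ?_ hl)
      rw [List.length_replicate]
      exact mul_le_mul_of_nonneg_left (dist_le_hundred _ _) (pow_nonneg (renorm_pos b).le _)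
  obtain ⟨g, hg, hg0, hgnn, hgpos⟩ := exists_integral_pos b
  have h1 : ∫ x, (f (bdry b n) - f' x) * g x ∂(selfSimilarMeasure b) =
      f (bdry b n) * ∫ x, g x ∂(selfSimilarMeasure b) := by
    have e := integral_sub ((integrable_selfSimilarMeasure g).const_mul (f (bdry b n)))
      (integrable_selfSimilarMeasure (f' * g))
    simp only [ContinuousMap.mul_apply, hf' g hg hg0, sub_zero, integral_const_mul] at e
    rw [← e]
    exact integral_congr_ae (ae_of_all _ fun x => sub_mul _ _ _)
  have h2 : ‖∫ x, (f (bdry b n) - f' x) * g x ∂(selfSimilarMeasure b)‖ ≤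
      ∫ x, ε * g x ∂(selfSimilarMeasure b) := by
    refine norm_integral_le_of_norm_le ((integrable_selfSimilarMeasure g).const_mul ε)
      (ae_of_all _ fun x => ?_)
    rw [Real.norm_eq_abs, abs_mul, abs_of_nonneg (hgnn x)]
    exact mul_le_mul_of_nonneg_right (hclose x) (hgnn x)
  rw [h1, integral_const_mul, Real.norm_eq_abs, abs_mul, abs_of_pos hgpos] at h2
  exact le_of_mul_le_mul_right h2 hgpos

theorem IsAnnihilator.eq_zero {b : ℕ} [NeZero b] {f : C(Fractal b, ℝ)}
    (hf : IsAnnihilator f) : f = 0 := by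
  have hend : ∀ w n, f (endpoint w n : BubbleVertex b) = 0 := fun w n => by
    obtain ⟨f', h1, h2⟩ := hf.exists_comp_wordMap w
    exact (h2 (q n)).symm.trans (h1.bdry_eq_zero n)
  have hb := Nat.pos_of_ne_zero (NeZero.ne b)
  refine ext_restr fun p => ?_
  cases p with
  | q n => exact hend [] n
  | mid w n =>
    -- Since $b\ge1$, the letter $0$ is a middle copy, whose end points inside the edge $w$ are the
    -- two new vertices.
    have h := hend (w ++ [⟨0, by omega⟩]) n
    rw [endpoint_append, if_neg (by simp [hb.ne]), if_neg (by simp)] at h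
    exact h

/-! ### Linearity and well-definedness of the Laplacian -/

theorem integral_add_mul {b : ℕ} [NeZero b] (f f' g : C(Fractal b, ℝ)) :
    ∫ x, (f + f') x * g x ∂(selfSimilarMeasure b) =
      ∫ x, f x * g x ∂(selfSimilarMeasure b) + ∫ x, f' x * g x ∂(selfSimilarMeasure b) := by
  refine Eq.trans ?_ (integral_add (integrable_selfSimilarMeasure (f * g))
    (integrable_selfSimilarMeasure (f' * g)))
  exact integral_congr_ae (ae_of_all _ fun x => add_mul _ _ _)

theorem integral_smul_mul {b : ℕ} [NeZero b] (c : ℝ) (f g : C(Fractal b, ℝ)) :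
    ∫ x, (c • f) x * g x ∂(selfSimilarMeasure b) =
      c * ∫ x, f x * g x ∂(selfSimilarMeasure b) := by
  rw [← integral_const_mul]
  exact integral_congr_ae (ae_of_all _ fun x => mul_assoc _ _ _)

theorem HasLaplacian.add {b : ℕ} [NeZero b] {u v f g : C(Fractal b, ℝ)}
    (hu : HasLaplacian u f) (hv : HasLaplacian v g) : HasLaplacian (u + v) (f + g) := by
  refine ⟨mem_domEnergy.1 ((domEnergy b).add_mem hu.1 hv.1), fun φ hφ h0 => ?_⟩
  rw [energyForm_add_left hu.1 hv.1 hφ, hu.2 φ hφ h0, hv.2 φ hφ h0, integral_add_mul]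
  ring

theorem HasLaplacian.smul {b : ℕ} [NeZero b] {u f : C(Fractal b, ℝ)} (c : ℝ)
    (hu : HasLaplacian u f) : HasLaplacian (c • u) (c • f) := by
  refine ⟨mem_domEnergy.1 ((domEnergy b).smul_mem c hu.1), fun φ hφ h0 => ?_⟩
  rw [energyForm_smul_left c hu.1 hφ, hu.2 φ hφ h0, integral_smul_mul]
  ring

theorem HasLaplacian.unique {b : ℕ} [NeZero b] {u f g : C(Fractal b, ℝ)}
    (hf : HasLaplacian u f) (hg : HasLaplacian u g) : f = g := by
  have h : IsAnnihilator (f + (-1 : ℝ) • g) := fun φ hφ h0 => by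
    rw [integral_add_mul, integral_smul_mul]
    linarith [hf.2 φ hφ h0, hg.2 φ hφ h0]
  have := h.eq_zero
  rwa [neg_one_smul, ← sub_eq_add_neg, sub_eq_zero] at this

theorem HasLaplacian.laplacian_eq {b : ℕ} [NeZero b] {u f : C(Fractal b, ℝ)}
    (h : HasLaplacian u f) : laplacian u = f := by
  have hex : ∃ f, HasLaplacian u f := ⟨f, h⟩
  rw [laplacian, dif_pos hex]
  exact hex.choose_spec.unique h

theorem hasLaplacian_laplacian {b : ℕ} [NeZero b] {u : C(Fractal b, ℝ)}
    (h : u ∈ domLaplacian b) : HasLaplacian u (laplacian u) := by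
  obtain ⟨f, hf⟩ := h
  rwa [hf.laplacian_eq]

/-- Here $u$ is its own test function, so $\mathcal E(u,u)=0$. -/
theorem HasLaplacian.eq_zero {b : ℕ} [NeZero b] {u : C(Fractal b, ℝ)}
    (h : HasLaplacian u 0) (h0 : ∀ n, u (bdry b n) = 0) : u = 0 := by
  refine eq_zero_of_energy_eq_zero h.1 ?_ (h0 0)
  rw [← energyForm_self h.1, h.2 u h.1 h0]
  simp

/-! ### The Dirichlet problem -/

theorem abs_integral_mul_le {b : ℕ} [NeZero b] (f : C(Fractal b, ℝ)) {g : C(Fractal b, ℝ)}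
    {C : ℝ} (hg : ∀ x, |g x| ≤ C) : |∫ x, f x * g x ∂(selfSimilarMeasure b)| ≤ ‖f‖ * C := by
  have h := norm_integral_le_of_norm_le_const (μ := selfSimilarMeasure b)
    (f := fun x => f x * g x) (C := ‖f‖ * C) (ae_of_all _ fun x => ?_)
  · simpa using h
  · rw [norm_mul]
    exact mul_le_mul (f.norm_coe_le_norm x) (hg x) (norm_nonneg _) (norm_nonneg _)

theorem continuous_integral_mul {b : ℕ} [NeZero b] (f : C(Fractal b, ℝ)) :
    Continuous fun u : C(Fractal b, ℝ) => ∫ x, u x * f x ∂(selfSimilarMeasure b) := by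
  refine (LipschitzWith.of_dist_le_mul (K := ‖f‖₊) fun u v => ?_).continuous
  have h := integral_add_mul u ((-1 : ℝ) • v) f
  rw [integral_smul_mul, neg_one_mul, ← sub_eq_add_neg, neg_one_smul, ← sub_eq_add_neg] at h
  rw [Real.dist_eq, ← h]
  simp only [mul_comm _ (f _)]
  refine abs_integral_mul_le f fun x => ?_
  rw [dist_eq_norm]
  exact (u - v).norm_coe_le_norm x

theorem continuous_levelEnergy_restr {b : ℕ} [NeZero b] (l : ℕ) :
    Continuous fun u : C(Fractal b, ℝ) => levelEnergy l (restr u) := by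
  unfold levelEnergy
  fun_prop

/-- Dirichlet principle: $J(u)=\mathcal E(u)+2\int uf\,d\mu$ attains its infimum over the functions
with the given boundary values, and the Euler–Lagrange equation is $\mathcal E(u,g)=-\int fg\,d\mu$.
-/
theorem exists_hasLaplacian {b : ℕ} [NeZero b] (f : C(Fractal b, ℝ)) (a : Fin 2 → ℝ) :
    ∃ u : C(Fractal b, ℝ), HasLaplacian u f ∧ ∀ n, u (bdry b n) = a n := by
  let I : C(Fractal b, ℝ) → ℝ := fun u => ∫ x, u x * f x ∂(selfSimilarMeasure b)
  have I_add : ∀ u v, I (u + v) = I u + I v := fun u v => integral_add_mul u v f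
  have I_smul : ∀ (c : ℝ) u, I (c • u) = c * I u := fun c u => integral_smul_mul c u f
  let J : C(Fractal b, ℝ) → ℝ := fun u => energy (restr u) + 2 * I u
  let S : Set C(Fractal b, ℝ) := {u | InDomEnergy u ∧ ∀ n, u (bdry b n) = a n}
  have hbdd : BddBelow (J '' S) := by
    -- From $|\int uf\,d\mu|\le\|f\|(|a_0|+5\sqrt{\mathcal E(u)})$, completing the square in
    -- $\sqrt{\mathcal E(u)}$ leaves this bound.
    refine ⟨-(2 * ‖f‖ * |a 0|) - 25 * ‖f‖ ^ 2, ?_⟩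
    rintro _ ⟨u, ⟨hu, hua⟩, rfl⟩
    have h1 : |I u| ≤ ‖f‖ * (|a 0| + 5 * √(energy (restr u))) := by
      simp only [I, mul_comm _ (f _)]
      refine abs_integral_mul_le f fun x => ?_
      have h2 := abs_sub_bdry_le hu x
      rw [hua] at h2
      have h3 := abs_sub_abs_le_abs_sub (u x) (a 0)
      linarith
    have h2 := (abs_le.1 h1).1
    have h3 := Real.sq_sqrt (energy_nonneg (restr u))
    simp only [J]
    nlinarith [sq_nonneg (√(energy (restr u)) - 5 * ‖f‖)]
  obtain ⟨u₀, hu₀⟩ := exists_inDomEnergy_bdry (b := b) a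
  have hne : (J '' S).Nonempty := ⟨_, u₀, hu₀, rfl⟩
  set m := sInf (J '' S)
  have hm : ∀ u ∈ S, m ≤ J u := fun u hu => csInf_le hbdd ⟨u, hu, rfl⟩
  have hseq : ∀ n : ℕ, ∃ u ∈ S, J u < m + 1 / (n + 1) := fun n => by
    obtain ⟨_, ⟨u, hu, rfl⟩, h⟩ := exists_lt_of_csInf_lt hne
      (show m < m + 1 / ((n : ℝ) + 1) from lt_add_of_pos_right _ (by positivity))
    exact ⟨u, hu, h⟩
  choose s hsS hsJ using hseq
  -- By the parallelogram law $\mathcal E(u-v)=2J(u)+2J(v)-4J(\tfrac12(u+v))$, and the midpoint is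
  -- admissible. Hence minimizing sequences are Cauchy in energy; their differences vanish at $q_1$,
  -- so they are Cauchy uniformly too.
  have hpar : ∀ u ∈ S, ∀ v ∈ S, energy (restr (u - v)) ≤ 2 * (J u - m) + 2 * (J v - m) := by
    rintro u ⟨hu, hua⟩ v ⟨hv, hva⟩
    have huv := mem_domEnergy.1 ((domEnergy b).add_mem hu hv)
    have hmid : (1 / 2 : ℝ) • (u + v) ∈ S := by
      refine ⟨mem_domEnergy.1 ((domEnergy b).smul_mem _ huv), fun n => ?_⟩
      simp only [ContinuousMap.smul_apply, ContinuousMap.add_apply, hua, hva, smul_eq_mul]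
      ring
    have h1 := hm _ hmid
    simp only [J, energy_smul _ huv, I_add, I_smul] at h1 ⊢
    linarith [energy_parallelogram hu hv]
  have hcauchy : CauchySeq s := by
    refine cauchySeq_of_le_tendsto_0 (fun N : ℕ => 5 * √(4 * (1 / ((N : ℝ) + 1)))) ?_ ?_
    · intro n k N hn hk
      have hE : energy (restr (s n - s k)) ≤ 4 * (1 / ((N : ℝ) + 1)) := by
        have hle : ∀ i : ℕ, N ≤ i → 1 / ((i : ℝ) + 1) ≤ 1 / ((N : ℝ) + 1) := fun i hi =>
          Nat.one_div_le_one_div hi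
        linarith [hpar _ (hsS n) _ (hsS k), hsJ n, hsJ k, hle n hn, hle k hk]
      rw [ContinuousMap.dist_le (by positivity)]
      intro x
      have h := abs_sub_bdry_le (mem_domEnergy.1 ((domEnergy b).sub_mem (hsS n).1 (hsS k).1)) x
      simp only [ContinuousMap.sub_apply, (hsS n).2, (hsS k).2, sub_self, sub_zero] at h
      rw [Real.dist_eq]
      exact h.trans (mul_le_mul_of_nonneg_left (Real.sqrt_le_sqrt hE) (by norm_num))
    · have h := ((tendsto_one_div_add_atTop_nhds_zero_nat (𝕜 := ℝ)).const_mul 4).sqrt.const_mul 5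
      simpa using h
  obtain ⟨u, hu⟩ := cauchySeq_tendsto_of_complete hcauchy
  -- Lower semicontinuity of the energy: each level energy is continuous for uniform convergence,
  -- and the energy is their supremum.
  have hlevel : ∀ l, levelEnergy l (restr u) + 2 * I u ≤ m := fun l => by
    have h1 := ((continuous_levelEnergy_restr l).tendsto u).comp hu
    have h2 := ((continuous_integral_mul f).tendsto u).comp hu
    have h3 := (tendsto_one_div_add_atTop_nhds_zero_nat (𝕜 := ℝ)).const_add m
    rw [add_zero] at h3
    refine le_of_tendsto_of_tendsto' (h1.add (h2.const_mul 2)) h3 fun n => ?_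
    refine le_trans ?_ (hsJ n).le
    exact add_le_add_left (levelEnergy_le_energy (hsS n).1 l) _
  have huE : InDomEnergy u := ⟨m - 2 * I u, by
    rintro _ ⟨l, rfl⟩
    exact le_sub_iff_add_le.2 (hlevel l)⟩
  have huJ : J u ≤ m :=
    le_sub_iff_add_le.1 (ciSup_le fun l => le_sub_iff_add_le.2 (hlevel l))
  have hua : ∀ n, u (bdry b n) = a n := fun n =>
    tendsto_nhds_unique (((continuous_eval_const (F := C(Fractal b, ℝ)) (bdry b n)).tendsto u).comp hu)
      (by simp [Function.comp_def, (hsS _).2])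
  refine ⟨u, ⟨huE, fun g hg hg0 => ?_⟩, hua⟩
  -- This is $J(u+tg)-J(u)$ up to the bound $J(u)\le m$. A nonnegative quadratic without constant
  -- term has no linear term, by its discriminant.
  have hquad : ∀ t : ℝ, 0 ≤ energy (restr g) * (t * t) + 2 * (energyForm u g + I g) * t + 0 :=
      fun t => by
    have hS : u + t • g ∈ S := by
      refine ⟨mem_domEnergy.1 ((domEnergy b).add_mem huE ((domEnergy b).smul_mem t hg)),
        fun n => ?_⟩
      simp [hua, hg0]
    have h := huJ.trans (hm _ hS)
    simp only [J, energy_add_smul t huE hg, I_add, I_smul] at h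
    linarith
  have hd := discrim_le_zero hquad
  simp only [discrim, mul_zero, sub_zero] at hd
  have h0 : energyForm u g + I g = 0 := by nlinarith [sq_nonneg (energyForm u g + I g)]
  rw [eq_neg_of_add_eq_zero_left h0]
  simp only [I, mul_comm]

/-! ### Polynomials -/

theorem mem_polynomials_zero {b : ℕ} [NeZero b] {u : C(Fractal b, ℝ)} :
    u ∈ polynomials b 0 ↔ HasLaplacian u 0 := by
  refine ⟨fun h => ?_, fun h => ⟨fun m hm => ?_, h.laplacian_eq⟩⟩
  · have h1 := hasLaplacian_laplacian (h.1 0 le_rfl)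
    have h2 : laplacian u = 0 := h.2
    rwa [Function.iterate_zero, id, h2] at h1
  · rw [Nat.le_zero.1 hm]
    exact ⟨0, h⟩

/-- This recursion drives the inductions on the degree. -/
theorem mem_polynomials_succ {b : ℕ} [NeZero b] {j : ℕ} {u : C(Fractal b, ℝ)} :
    u ∈ polynomials b (j + 1) ↔ u ∈ domLaplacian b ∧ laplacian u ∈ polynomials b j := by
  refine ⟨fun h => ⟨h.1 0 (Nat.zero_le _), fun m hm => h.1 (m + 1) (by omega), h.2⟩,
    fun h => ⟨fun m hm => ?_, h.2.2⟩⟩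
  cases m with
  | zero => exact h.1
  | succ m => exact h.2.1 m (by omega)

theorem HasLaplacian.mem_polynomials_succ {b : ℕ} [NeZero b] {j : ℕ} {u f : C(Fractal b, ℝ)}
    (h : HasLaplacian u f) (hf : f ∈ polynomials b j) : u ∈ polynomials b (j + 1) :=
  BubbleDiamond.mem_polynomials_succ.2 ⟨⟨f, h⟩, by rwa [h.laplacian_eq]⟩

theorem hasLaplacian_zero (b : ℕ) [NeZero b] : HasLaplacian (0 : C(Fractal b, ℝ)) 0 := by
  refine ⟨finiteEnergy_const 0, fun g hg _ => ?_⟩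
  have := energyForm_smul_left (0 : ℝ) (mem_domEnergy.1 (domEnergy b).zero_mem) hg
  simpa using this

/-- `𝓗_j` as a vector space. -/
noncomputable def polynomialsSubmodule (b : ℕ) [NeZero b] (j : ℕ) :
    Submodule ℝ C(Fractal b, ℝ) where
  carrier := polynomials b j
  zero_mem' := by
    induction j with
    | zero => exact mem_polynomials_zero.2 (hasLaplacian_zero b)
    | succ j ih => exact (hasLaplacian_zero b).mem_polynomials_succ ih
  add_mem' {u v} hu hv := by
    induction j generalizing u v with
    | zero =>
      rw [mem_polynomials_zero] at *
      simpa using hu.add hv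
    | succ j ih =>
      rw [mem_polynomials_succ] at hu hv
      exact ((hasLaplacian_laplacian hu.1).add (hasLaplacian_laplacian hv.1)).mem_polynomials_succ
        (ih hu.2 hv.2)
  smul_mem' c u hu := by
    induction j generalizing u with
    | zero =>
      rw [mem_polynomials_zero] at *
      simpa using hu.smul c
    | succ j ih =>
      rw [mem_polynomials_succ] at hu
      exact ((hasLaplacian_laplacian hu.1).smul c).mem_polynomials_succ (ih _ hu.2)

theorem mem_polynomialsSubmodule {b : ℕ} [NeZero b] {j : ℕ} {u : C(Fractal b, ℝ)} :
    u ∈ polynomialsSubmodule b j ↔ u ∈ polynomials b j := Iff.rfl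

theorem polynomials_mono (b : ℕ) [NeZero b] : Monotone (polynomials b) := by
  refine monotone_nat_of_le_succ fun j => ?_
  induction j with
  | zero =>
    intro u hu
    exact (mem_polynomials_zero.1 hu).mem_polynomials_succ (polynomialsSubmodule b 0).zero_mem
  | succ j ih =>
    intro u hu
    rw [mem_polynomials_succ] at hu
    exact mem_polynomials_succ.2 ⟨hu.1, ih hu.2⟩

/-- `laplacian` has the default value $0$ off its domain; membership in $\mathcal H_j$ keeps all the
iterates used here inside the domain, where it is additive. -/
theorem iterate_laplacian_add {b : ℕ} [NeZero b] {j m : ℕ} (hm : m ≤ j) {u v : C(Fractal b, ℝ)}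
    (hu : u ∈ polynomials b j) (hv : v ∈ polynomials b j) :
    laplacian^[m] (u + v) = laplacian^[m] u + laplacian^[m] v := by
  induction m generalizing j u v with
  | zero => rfl
  | succ m ih =>
    obtain ⟨j, rfl⟩ : ∃ i, j = i + 1 := ⟨j - 1, by omega⟩
    rw [mem_polynomials_succ] at hu hv
    simp only [Function.iterate_succ_apply]
    rw [((hasLaplacian_laplacian hu.1).add (hasLaplacian_laplacian hv.1)).laplacian_eq]
    exact ih (by omega) hu.2 hv.2

theorem iterate_laplacian_smul {b : ℕ} [NeZero b] {j m : ℕ} (hm : m ≤ j) (c : ℝ)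
    {u : C(Fractal b, ℝ)} (hu : u ∈ polynomials b j) :
    laplacian^[m] (c • u) = c • laplacian^[m] u := by
  induction m generalizing j u with
  | zero => rfl
  | succ m ih =>
    obtain ⟨j, rfl⟩ : ∃ i, j = i + 1 := ⟨j - 1, by omega⟩
    rw [mem_polynomials_succ] at hu
    simp only [Function.iterate_succ_apply]
    rw [((hasLaplacian_laplacian hu.1).smul c).laplacian_eq]
    exact ih (by omega) hu.2

theorem comp_cellMap_mem_polynomials {b : ℕ} [NeZero b] {j : ℕ} {u : C(Fractal b, ℝ)}
    (hu : u ∈ polynomials b j) (i : Fin (b + 2)) : u.comp (cellMap i) ∈ polynomials b j := by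
  induction j generalizing u with
  | zero =>
    rw [mem_polynomials_zero] at *
    simpa using hu.comp_cellMap i
  | succ j ih =>
    rw [mem_polynomials_succ] at hu
    exact ((hasLaplacian_laplacian hu.1).comp_cellMap i).mem_polynomials_succ
      ((polynomialsSubmodule b j).smul_mem _ (ih hu.2))

theorem iterate_laplacian_comp_cellMap {b : ℕ} [NeZero b] {j m : ℕ} (hm : m ≤ j)
    {u : C(Fractal b, ℝ)} (hu : u ∈ polynomials b j) (i : Fin (b + 2)) :
    laplacian^[m] (u.comp (cellMap i)) =
      (renorm b / (b + 2)) ^ m • (laplacian^[m] u).comp (cellMap i) := by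
  induction m generalizing j u with
  | zero => simp
  | succ m ih =>
    obtain ⟨j, rfl⟩ : ∃ i, j = i + 1 := ⟨j - 1, by omega⟩
    rw [mem_polynomials_succ] at hu
    simp only [Function.iterate_succ_apply]
    rw [((hasLaplacian_laplacian hu.1).comp_cellMap i).laplacian_eq,
      iterate_laplacian_smul (j := j) (by omega) _ (comp_cellMap_mem_polynomials hu.2 i),
      ih (by omega) hu.2, smul_smul, pow_succ']

/-! ### Polynomials are determined by their boundary data -/

/-- The boundary data `Δ^m u (q_n)` of a polynomial. -/
noncomputable def boundaryData (b : ℕ) [NeZero b] (j : ℕ) :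
    polynomialsSubmodule b j →ₗ[ℝ] (Fin (j + 1) × Fin 2 → ℝ) where
  toFun u p := (laplacian^[(p.1 : ℕ)] (u : C(Fractal b, ℝ))) (bdry b p.2)
  map_add' u v := by
    ext p
    simp only [Submodule.coe_add, Pi.add_apply]
    rw [iterate_laplacian_add (Nat.le_of_lt_succ p.1.2) u.2 v.2, ContinuousMap.add_apply]
  map_smul' c u := by
    ext p
    simp only [Submodule.coe_smul, Pi.smul_apply, RingHom.id_apply]
    rw [iterate_laplacian_smul (Nat.le_of_lt_succ p.1.2) c u.2, ContinuousMap.smul_apply]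

/-- By induction $\Delta u=0$, so $u$ is harmonic with zero boundary values. -/
theorem eq_zero_of_mem_polynomials {b : ℕ} [NeZero b] {j : ℕ} {u : C(Fractal b, ℝ)}
    (hu : u ∈ polynomials b j) (h : ∀ m ≤ j, ∀ n, (laplacian^[m] u) (bdry b n) = 0) : u = 0 := by
  induction j generalizing u with
  | zero => exact (mem_polynomials_zero.1 hu).eq_zero (h 0 le_rfl)
  | succ j ih =>
    rw [mem_polynomials_succ] at hu
    have h1 := ih hu.2 fun m hm => h (m + 1) (by omega)
    have h2 := hasLaplacian_laplacian hu.1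
    rw [h1] at h2
    exact h2.eq_zero (h 0 (Nat.zero_le _))

theorem boundaryData_injective (b : ℕ) [NeZero b] (j : ℕ) :
    Function.Injective (boundaryData b j) := by
  rw [← LinearMap.ker_eq_bot, LinearMap.ker_eq_bot']
  intro u hu
  refine Subtype.ext (eq_zero_of_mem_polynomials u.2 fun m hm n => ?_)
  exact congrFun hu (⟨m, by omega⟩, n)

theorem IsBasicPolynomial.unique {b : ℕ} [NeZero b] {j : ℕ} {k : Fin 2} {u v : C(Fractal b, ℝ)}
    (hu : IsBasicPolynomial j k u) (hv : IsBasicPolynomial j k v) : u = v := by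
  have h : boundaryData b j ⟨u, hu.1⟩ = boundaryData b j ⟨v, hv.1⟩ := by
    ext p
    exact (hu.2 _ (Nat.le_of_lt_succ p.1.2) _).trans (hv.2 _ (Nat.le_of_lt_succ p.1.2) _).symm
  exact congrArg Subtype.val (boundaryData_injective b j h)

/-- Start with a harmonic function with boundary values $\delta_{kn}$; then solve $\Delta u=f_{jk}$
with zero boundary values to pass from $j$ to $j+1$. -/
theorem exists_isBasicPolynomial (b : ℕ) [NeZero b] (j : ℕ) (k : Fin 2) :
    ∃ u : C(Fractal b, ℝ), IsBasicPolynomial j k u := by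
  induction j with
  | zero =>
    obtain ⟨u, hu, hk⟩ := exists_hasLaplacian (b := b) 0 fun n => if n = k then 1 else 0
    refine ⟨u, mem_polynomials_zero.2 hu, fun m hm n => ?_⟩
    rw [Nat.le_zero.1 hm, if_pos rfl, one_mul]
    exact hk n
  | succ j ih =>
    obtain ⟨f, hf⟩ := ih
    obtain ⟨u, hu, hk⟩ := exists_hasLaplacian f fun _ => 0
    refine ⟨u, hu.mem_polynomials_succ hf.1, fun m hm n => ?_⟩
    cases m with
    | zero => simpa using hk n
    | succ m =>
      rw [Function.iterate_succ_apply, hu.laplacian_eq, hf.2 m (by omega) n]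
      simp

theorem IsBasicPolynomial.laplacian {b : ℕ} [NeZero b] {j : ℕ} {k : Fin 2}
    {u : C(Fractal b, ℝ)} (hu : IsBasicPolynomial (j + 1) k u) :
    IsBasicPolynomial j k (laplacian u) := by
  refine ⟨(mem_polynomials_succ.1 hu.1).2, fun m hm n => ?_⟩
  have := hu.2 (m + 1) (by omega) n
  rw [Function.iterate_succ_apply] at this
  simpa using this

/-! ### The basic polynomials as dual basis, and their self-similar expansion -/

section Family

variable {b : ℕ} [NeZero b] {f : ℕ → Fin 2 → C(Fractal b, ℝ)}

/-- Since $\Delta f_{j+1,k}$ satisfies the conditions that single out $f_{jk}$, the two coincide. -/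
theorem iterate_laplacian_basic (hf : ∀ j k, IsBasicPolynomial j k (f j k)) {j m : ℕ}
    (hm : m ≤ j) (k : Fin 2) : laplacian^[m] (f j k) = f (j - m) k := by
  induction m generalizing j with
  | zero => rfl
  | succ m ih =>
    obtain ⟨j, rfl⟩ : ∃ i, j = i + 1 := ⟨j - 1, by omega⟩
    rw [Function.iterate_succ_apply, ((hf (j + 1) k).laplacian).unique (hf j k), ih (by omega),
      Nat.add_sub_add_right]

theorem iterate_laplacian_zero (b : ℕ) [NeZero b] (m : ℕ) :
    laplacian^[m] (0 : C(Fractal b, ℝ)) = 0 :=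
  Function.iterate_fixed (hasLaplacian_zero b).laplacian_eq m

/-- The bound $m\le j$ is dropped, because lower-degree polynomials must be paired with the higher
functionals of $\mathcal H_j$; there the iterate is $0$. -/
theorem iterate_laplacian_basic_bdry (hf : ∀ j k, IsBasicPolynomial j k (f j k)) (j m : ℕ)
    (k n : Fin 2) : (laplacian^[m] (f j k)) (bdry b n) =
      (if m = j then 1 else 0) * (if n = k then 1 else 0) := by
  rcases le_or_gt m j with h | h
  · exact (hf j k).2 m h n
  · obtain ⟨d, rfl⟩ := Nat.exists_eq_add_of_lt h
    rw [show j + d + 1 = d + (j + 1) by ring, Function.iterate_add_apply, (hf j k).1.2,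
      iterate_laplacian_zero, if_neg (by omega)]
    simp

theorem boundaryData_basic (hf : ∀ j k, IsBasicPolynomial j k (f j k)) (j : ℕ)
    (p : Fin (j + 1) × Fin 2) :
    boundaryData b j ⟨f p.1 p.2, polynomials_mono b (Nat.le_of_lt_succ p.1.2) (hf _ _).1⟩ =
      Pi.single p 1 := by
  ext p'
  refine (iterate_laplacian_basic_bdry hf _ _ _ _).trans ?_
  simp only [Pi.single_apply, Prod.ext_iff, Fin.ext_iff, ite_and]
  split_ifs <;> simp

theorem boundaryData_surjective (b : ℕ) [NeZero b] (j : ℕ) :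
    Function.Surjective (boundaryData b j) := by
  choose f hf using exists_isBasicPolynomial b
  intro a
  refine ⟨∑ p : Fin (j + 1) × Fin 2, a p •
    ⟨f p.1 p.2, polynomials_mono b (Nat.le_of_lt_succ p.1.2) (hf _ _).1⟩, ?_⟩
  simp only [map_sum, map_smul, boundaryData_basic hf]
  exact (pi_eq_sum_univ' a).symm

/-- The basis of `𝓗_j` dual to the boundary data. -/
noncomputable def polynomialBasis (b : ℕ) [NeZero b] (j : ℕ) :
    Module.Basis (Fin (j + 1) × Fin 2) ℝ (polynomialsSubmodule b j) :=
  Module.Basis.ofEquivFun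
    (LinearEquiv.ofBijective _ ⟨boundaryData_injective b j, boundaryData_surjective b j⟩)

theorem polynomialBasis_apply (hf : ∀ j k, IsBasicPolynomial j k (f j k)) (j : ℕ)
    (p : Fin (j + 1) × Fin 2) : (polynomialBasis b j p : C(Fractal b, ℝ)) = f p.1 p.2 := by
  have h : polynomialBasis b j p =
      ⟨f p.1 p.2, polynomials_mono b (Nat.le_of_lt_succ p.1.2) (hf _ _).1⟩ := by
    rw [polynomialBasis, Module.Basis.coe_ofEquivFun, LinearEquiv.symm_apply_eq]
    exact (boundaryData_basic hf j p).symm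
  rw [h]

/-- The coordinates in the dual basis are the boundary data. Conversely, any combination of these
$f_{mk}$ lies in $\mathcal H_j$, whatever its coefficients. -/
theorem mem_polynomials_iff (hf : ∀ j k, IsBasicPolynomial j k (f j k)) {j : ℕ}
    {u : C(Fractal b, ℝ)} : u ∈ polynomials b j ↔
      u = ∑ m ∈ Finset.range (j + 1), ∑ k : Fin 2, (laplacian^[m] u) (bdry b k) • f m k := by
  constructor
  · intro hu
    have h := congrArg Subtype.val ((polynomialBasis b j).sum_equivFun ⟨u, hu⟩)
    rw [Submodule.coe_sum, Fintype.sum_prod_type] at h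
    simp only [Submodule.coe_smul, polynomialBasis_apply hf] at h
    rw [← Fin.sum_univ_eq_sum_range
      (fun m => ∑ k : Fin 2, (laplacian^[m] u) (bdry b k) • f m k)]
    refine h.symm.trans (Finset.sum_congr rfl fun m _ => Finset.sum_congr rfl fun k _ => ?_)
    rw [polynomialBasis, Module.Basis.equivFun_ofEquivFun]
    rfl
  · intro h
    rw [← mem_polynomialsSubmodule, h]
    refine Submodule.sum_mem _ fun m hm => Submodule.sum_mem _ fun k _ =>
      Submodule.smul_mem _ _ (polynomials_mono b ?_ (hf m k).1)
    exact Nat.le_of_lt_succ (Finset.mem_range.1 hm)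

theorem basic_comp_cellMap (hf : ∀ j k, IsBasicPolynomial j k (f j k)) (j : ℕ) (i : Fin (b + 2))
    (k : Fin 2) : (f j k).comp (cellMap i) = ∑ m ∈ Finset.range (j + 1), ∑ n : Fin 2,
      ((renorm b / (b + 2)) ^ m * f (j - m) k (fractalMap i (bdry b n))) • f m n := by
  refine ((mem_polynomials_iff hf).1 (comp_cellMap_mem_polynomials (hf j k).1 i)).trans
    (Finset.sum_congr rfl fun m hm => Finset.sum_congr rfl fun n _ => ?_)
  have hm' := Nat.le_of_lt_succ (Finset.mem_range.1 hm)
  rw [iterate_laplacian_comp_cellMap hm' (hf j k).1, iterate_laplacian_basic hf hm']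
  rfl

end Family

end BubbleDiamond

theorem mainTheorem8 (b : ℕ) [NeZero b] :
    (∀ (j : ℕ) (k : Fin 2), ∃! u : C(BubbleDiamond.Fractal b, ℝ),
      BubbleDiamond.IsBasicPolynomial j k u) ∧
    ∀ f : ℕ → Fin 2 → C(BubbleDiamond.Fractal b, ℝ),
      (∀ j k, BubbleDiamond.IsBasicPolynomial j k (f j k)) →
      ∀ j : ℕ,
        (∃ H : Submodule ℝ C(BubbleDiamond.Fractal b, ℝ),
          (H : Set C(BubbleDiamond.Fractal b, ℝ)) = BubbleDiamond.polynomials b j ∧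
          Module.finrank ℝ H = 2 * j + 2 ∧
          ∃ B : Module.Basis (Fin (j + 1) × Fin 2) ℝ H,
            ∀ (m : Fin (j + 1)) (k : Fin 2), (B (m, k) : C(BubbleDiamond.Fractal b, ℝ)) = f m k) ∧
        (∀ u : C(BubbleDiamond.Fractal b, ℝ), u ∈ BubbleDiamond.polynomials b j ↔
          u = ∑ m ∈ Finset.range (j + 1), ∑ k : Fin 2,
            (BubbleDiamond.laplacian^[m] u) (BubbleDiamond.bdry b k) • f m k) ∧
        (∀ (i : Fin (b + 2)) (k : Fin 2) (x : BubbleDiamond.Fractal b),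
          f j k (BubbleDiamond.fractalMap i x) =
            ∑ m ∈ Finset.range (j + 1), ∑ n : Fin 2,
              (BubbleDiamond.renorm b / (b + 2)) ^ m *
                f (j - m) k (BubbleDiamond.fractalMap i (BubbleDiamond.bdry b n)) * f m n x) := by
  refine ⟨fun j k => ?_, fun f hf j => ⟨⟨BubbleDiamond.polynomialsSubmodule b j, rfl, ?_,
    BubbleDiamond.polynomialBasis b j, fun m k => BubbleDiamond.polynomialBasis_apply hf j (m, k)⟩,
    fun u => BubbleDiamond.mem_polynomials_iff hf, fun i k x => ?_⟩⟩
  · obtain ⟨u, hu⟩ := BubbleDiamond.exists_isBasicPolynomial b j k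
    exact ⟨u, hu, fun v hv => hv.unique hu⟩
  · rw [Module.finrank_eq_card_basis (BubbleDiamond.polynomialBasis b j)]
    simp only [Fintype.card_prod, Fintype.card_fin]
    ring
  · have h := DFunLike.congr_fun (BubbleDiamond.basic_comp_cellMap hf j i k) x
    simpa [ContinuousMap.sum_apply, BubbleDiamond.cellMap_apply, mul_assoc] using h
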